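/- Let $R$ be an Artin algebra, i.e. an algebra over a commutative Artinian ring $k$ which is finitely generated as a $k$-module. Let $\mathrm{mod}\,R$ be the abelian category of finitely generated left $R$-modules and $\mathbb{D}^b(\mathrm{mod}\,R)$ its bounded derived category. A module $M\in\mathrm{mod}\,R$ is Gorenstein projective if $M\cong\mathrm{Ker}(X^0\to X^1)$ for some acyclic complex $X^\bullet$ of finitely generated projective left $R$-modules such that $\mathrm{Hom}_R(X^\bullet,R)$ is also acyclic; let $\mathrm{Gproj}\,R\subseteq\mathrm{mod}\,R$ be the full subcategory of Gorenstein projective modules. Let $\mathbb{D}^b(\mathrm{mod}\,R)_{fgp}$ be the full subcategory of $\mathbb{D}^b(\mathrm{mod}\,R)$ of those objects which are isomorphic in $\mathbb{D}^b(\mathrm{mod}\,R)$ to a bounded complex all of whose terms are Gorenstein projective. Then $\mathbb{D}^b(\mathrm{mod}\,R)_{fgp}$ is a thick subcategory of $\mathbb{D}^b(\mathrm{mod}\,R)$, that is, a triangulated subcategory closed under direct summands. Furthermore, $$\mathbb{D}^b(\mathrm{mod}\,R)_{fgp}=\langle\mathrm{Gproj}\,R\rangle,$$ where $\langle\mathrm{Gproj}\,R\rangle$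 is the triangulated subcategory of $\mathbb{D}^b(\mathrm{mod}\,R)$ generated by $\mathrm{Gproj}\,R$, that is, the smallest full triangulated subcategory, closed under isomorphisms, which contains every Gorenstein projective module viewed as a stalk complex concentrated in degree zero. -/

import Mathlib

open CategoryTheory CategoryTheory.Limits CategoryTheory.Pretriangulated

universe w v u

/-- An Artin algebra is a left noetherian ring, so `mod R` is an abelian category. -/
theorem isNoetherianRing_of_artinAlgebra (k : Type v) (R : Type u) [CommRing k]
    [IsArtinianRing k] [Ring R] [Algebra k R] [Module.Finite k R] : IsNoetherianRing R :=
  IsNoetherianRing.of_finite k R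

section Gorenstein

variable (R : Type u) [Ring R] [IsNoetherianRing R]

/-- A complex `X` of finitely generated left `R`-modules is totally acyclic if it is an acyclic
complex of projective modules and the complex `Hom_R(X, R)` is acyclic: for every `i`, the
sequence `Hom_R(X^{i+1}, R) → Hom_R(X^i, R) → Hom_R(X^{i-1}, R)` of maps given by
precomposition with the differentials of `X` is exact. -/
structure IsTotallyAcyclic (X : CochainComplex (FGModuleCat.{u} R) ℤ) : Prop where
  projective : ∀ i : ℤ, Module.Projective R (X.X i)
  acyclic : X.Acyclic
  hom_acyclic : ∀ i : ℤ, Function.Exact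
    (fun g : X.X (i + 1) ⟶ FGModuleCat.of R R => X.d i (i + 1) ≫ g)
    (fun f : X.X i ⟶ FGModuleCat.of R R => X.d (i - 1) i ≫ f)

/-- `Gproj R`: the finitely generated Gorenstein projective left `R`-modules, that is, those
isomorphic to `Z^0(X) = Ker d^0` for some totally acyclic complex `X`. -/
def Gproj : ObjectProperty (FGModuleCat.{u} R) := fun M =>
  ∃ X : CochainComplex (FGModuleCat.{u} R) ℤ, IsTotallyAcyclic R X ∧ Nonempty (M ≅ X.cycles 0)

end Gorenstein

section Derived

/-- The embedding of an abelian category in its bounded derived category, which sends an object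
to the stalk complex concentrated in degree zero. -/
noncomputable def boundedStalk (C : Type u) [Category.{v} C] [Abelian C]
    [HasDerivedCategory.{w} C] : C ⥤ DerivedCategory.Bounded C :=
  DerivedCategory.TStructure.t.bounded.lift (DerivedCategory.singleFunctor C 0) (fun _ =>
    ⟨⟨0, inferInstance⟩, ⟨0, inferInstance⟩⟩)

/-- `D^b(mod R)_fgp`: the objects of `D^b(mod R)` of finite Gorenstein projective dimension,
that is, those isomorphic in the derived category to a bounded complex all of whose components
are Gorenstein projective. (`D^b(mod R)` is a full subcategory of `D(mod R)`, so it does not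
matter in which of the two the isomorphism is taken.) -/
def boundedFgp (R : Type u) [Ring R] [IsNoetherianRing R]
    [HasDerivedCategory.{w} (FGModuleCat.{u} R)] :
    ObjectProperty (DerivedCategory.Bounded (FGModuleCat.{u} R)) := fun X =>
  ∃ G : CochainComplex (FGModuleCat.{u} R) ℤ,
    (∃ a b : ℤ, G.IsStrictlyGE a ∧ G.IsStrictlyLE b) ∧ (∀ i : ℤ, Gproj R (G.X i)) ∧
      Nonempty (X.obj ≅ DerivedCategory.Q.obj G)

end Derived

section Triangulated

variable {T : Type u} [Category.{v} T] [HasZeroObject T] [HasShift T ℤ] [Preadditive T]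
  [∀ n : ℤ, (shiftFunctor T n).Additive] [Pretriangulated T]

/-- A full subcategory of a triangulated category is thick if it is a triangulated subcategory
which is closed under direct summands (retracts), hence also under isomorphisms. -/
structure IsThickSubcategory (P : ObjectProperty T) : Prop where
  isTriangulated : P.IsTriangulated
  isStableUnderRetracts : P.IsStableUnderRetracts

/-- The triangulated subcategory `⟨S⟩` generated by `S`: the intersection of all triangulated
subcategories, closed under isomorphisms, which contain `S`. Closure under direct summands is
not imposed. -/
def triangulatedSubcategoryGenerated (S : ObjectProperty T) : ObjectProperty T := fun X =>
  ∀ P : ObjectProperty T, P.IsTriangulated → P.IsClosedUnderIsomorphisms → S ≤ P → P X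

end Triangulated

/-!
# Bounded complexes of Gorenstein projective modules

Work in an abelian category `C` with enough projectives, here `mod R`. The Gorenstein projective
objects are the largest class in which each member `M` has a syzygy and a cosyzygy: short exact
sequences `0 ⟶ K ⟶ P ⟶ M ⟶ 0` and `0 ⟶ M ⟶ P' ⟶ L ⟶ 0` with `P`, `P'` projective and `K`, `L` again
in the class, which stay exact under `Hom(-, Q)` for `Q` projective. Splicing these sequences gives
a totally acyclic complex, and the cycles of such a complex form such a class
(`gproj_eq_gorensteinProjective`). From this coinductive description it follows, by exhibiting a
class closed under syzygies and cosyzygies each time, that Gorenstein projective objects are closed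
under extensions and direct summands.

The heart of the argument is that having a bounded model with Gorenstein projective terms is a
condition on one syzygy. An object `X` of the bounded derived category has a syzygy in each degree
`m`, the cokernel `M` of `P^{m-1} ⟶ P^m` for a projective resolution `P` of `X`. Instead of
choosing resolutions, it is characterised by a morphism `X ⟶ M[-m]` whose fibre is left orthogonal
to the objects in degrees `≤ m` (`IsLeftApprox`). In these terms
* the syzygy of an extension of two objects in the same degree is an extension of their syzygies
  (`IsLeftApprox.exists_of_extension`, `isShortExact_of_distinguished`);
* the syzygy of a retract is a retract of the syzygy, up to projective summands
  (`exists_stable_retract`, a form of Schanuel's lemma);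
* if `m` is small enough, then `X` is isomorphic to a bounded complex which has its syzygy in degree
  `m` and projective objects in the degrees above (`exists_model`).

By the first point the objects some syzygy of which is Gorenstein projective form a triangulated
subcategory (`finiteGorensteinDimension`); by the other two, each retract of such an object is
isomorphic to a bounded complex with Gorenstein projective terms
(`finiteGorensteinDimension.exists_iso_Q_obj_of_retract`). Conversely, induction on the length shows
that a bounded complex with Gorenstein projective terms lies in every triangulated subcategory which
contains the Gorenstein projective modules (`prop_of_iso_Q_obj`), and the above is one of them.
-/

/-! ### Short exact sequences and Gorenstein projective objects -/

namespace GorensteinProjective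

open scoped ZeroObject

section ShortExact

variable {C : Type u} [Category.{v} C] [Abelian C]

/-- The sequence `0 ⟶ A ⟶ E ⟶ B ⟶ 0` given by `i` and `p` is short exact. -/
def IsShortExact {A E B : C} (i : A ⟶ E) (p : E ⟶ B) : Prop :=
  ∃ w : i ≫ p = 0, (ShortComplex.mk i p w).ShortExact

namespace IsShortExact

variable {A E B : C} {i : A ⟶ E} {p : E ⟶ B}

lemma zero (h : IsShortExact i p) : i ≫ p = 0 := h.1

lemma mono (h : IsShortExact i p) : Mono i := h.2.mono_f

lemma epi (h : IsShortExact i p) : Epi p := h.2.epi_g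

lemma exists_lift (h : IsShortExact i p) {T : C} (x : T ⟶ E) (hx : x ≫ p = 0) :
    ∃ y : T ⟶ A, y ≫ i = x := by
  have := h.2.mono_f
  exact ⟨h.2.exact.lift x hx, h.2.exact.lift_f x hx⟩

lemma exists_desc (h : IsShortExact i p) {T : C} (x : E ⟶ T) (hx : i ≫ x = 0) :
    ∃ y : B ⟶ T, p ≫ y = x := by
  have := h.2.epi_g
  exact ⟨h.2.exact.desc x hx, h.2.exact.g_desc x hx⟩

lemma mk_of_lift (w : i ≫ p = 0) [Mono i] [Epi p]
    (h : ∀ {T : C} (x : T ⟶ E), x ≫ p = 0 → ∃ y : T ⟶ A, y ≫ i = x) : IsShortExact i p := by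
  refine ⟨w, { exact := ?_ }⟩
  rw [ShortComplex.exact_iff_exact_up_to_refinements]
  intro T x hx
  obtain ⟨y, hy⟩ := h x hx
  exact ⟨T, 𝟙 T, inferInstance, y, by simpa using hy.symm⟩

lemma mk_of_desc (w : i ≫ p = 0) [Mono i] [Epi p]
    (h : ∀ {T : C} (x : E ⟶ T), i ≫ x = 0 → ∃ y : B ⟶ T, p ≫ y = x) : IsShortExact i p := by
  refine mk_of_lift w fun x hx => ?_
  obtain ⟨y, hy⟩ := h (cokernel.π i) (cokernel.condition i)
  exact ⟨Abelian.monoLift i x (by rw [← hy, reassoc_of% hx, zero_comp]), Abelian.monoLift_comp ..⟩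

lemma kernel_ι (p : E ⟶ B) [Epi p] : IsShortExact (kernel.ι p) p :=
  mk_of_lift (kernel.condition p) fun x hx => ⟨kernel.lift p x hx, kernel.lift_ι _ _ _⟩

lemma cokernel_π (i : A ⟶ E) [Mono i] : IsShortExact i (cokernel.π i) :=
  mk_of_desc (cokernel.condition i) fun x hx => ⟨cokernel.desc i x hx, cokernel.π_desc _ _ _⟩

lemma of_iso {A' B' : C} (h : IsShortExact i p) (a : A' ≅ A) (b : B ≅ B') :
    IsShortExact (a.hom ≫ i) (p ≫ b.hom) := by
  have := h.mono
  have := h.epi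
  refine mk_of_lift (by simp [reassoc_of% h.zero]) fun x hx => ?_
  obtain ⟨y, hy⟩ := h.exists_lift x (by
    rw [← cancel_mono b.hom, Category.assoc, hx, zero_comp])
  exact ⟨y ≫ a.inv, by simpa using hy⟩

lemma id_zero (M : C) : IsShortExact (𝟙 M) (0 : M ⟶ 0) := by
  have : Epi (0 : M ⟶ 0) := ⟨fun _ _ _ => (isZero_zero C).eq_of_src _ _⟩
  exact mk_of_lift comp_zero fun x _ => ⟨x, Category.comp_id x⟩

lemma zero_id (M : C) : IsShortExact (0 : 0 ⟶ M) (𝟙 M) := by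
  have : Mono (0 : 0 ⟶ M) := ⟨fun _ _ _ => (isZero_zero C).eq_of_tgt _ _⟩
  exact mk_of_desc zero_comp fun x _ => ⟨x, Category.id_comp x⟩

lemma biprod_inl_snd (M N : C) :
    IsShortExact (biprod.inl : M ⟶ M ⊞ N) (biprod.snd : M ⊞ N ⟶ N) :=
  mk_of_lift biprod.inl_snd fun x hx => ⟨x ≫ biprod.fst, by
    ext
    · simp
    · simp [hx]⟩

/-- The direct sum of a short exact sequence with `0 ⟶ 0 ⟶ M ⟶ M ⟶ 0`. -/
lemma biprod_right (h : IsShortExact i p) (M : C) :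
    IsShortExact (i ≫ biprod.inl : A ⟶ E ⊞ M) (biprod.map p (𝟙 M)) := by
  have := h.mono
  have := h.epi
  refine mk_of_lift (by simp [reassoc_of% h.zero]) fun x hx => ?_
  obtain ⟨y, hy⟩ := h.exists_lift (x ≫ biprod.fst) (by
    simpa using hx =≫ biprod.fst)
  refine ⟨y, ?_⟩
  ext
  · simpa using hy
  · simpa using (hx =≫ biprod.snd).symm

/-- The direct sum of a short exact sequence with `0 ⟶ M ⟶ M ⟶ 0 ⟶ 0`. -/
lemma biprod_left (h : IsShortExact i p) (M : C) :
    IsShortExact (biprod.map i (𝟙 M)) (biprod.fst ≫ p : E ⊞ M ⟶ B) := by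
  have := h.mono
  have := h.epi
  refine mk_of_lift (by simp [h.zero]) fun x hx => ?_
  obtain ⟨y, hy⟩ := h.exists_lift (x ≫ biprod.fst) (by simpa using hx)
  refine ⟨biprod.lift y (x ≫ biprod.snd), ?_⟩
  ext
  · simpa using hy
  · simp

/-- The kernels of a surjection of short exact sequences form a short exact sequence. -/
lemma exists_of_kernel {A E B PA PE PB KA KE KB : C} {i : A ⟶ E} {p : E ⟶ B}
    {i' : PA ⟶ PE} {p' : PE ⟶ PB} {a : PA ⟶ A} {e : PE ⟶ E} {b : PB ⟶ B}
    {ka : KA ⟶ PA} {ke : KE ⟶ PE} {kb : KB ⟶ PB}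
    (h : IsShortExact i p) (h' : IsShortExact i' p')
    (ha : IsShortExact ka a) (he : IsShortExact ke e) (hb : IsShortExact kb b)
    (w₁ : i' ≫ e = a ≫ i) (w₂ : p' ≫ b = e ≫ p) :
    ∃ (j : KA ⟶ KE) (q : KE ⟶ KB),
      IsShortExact j q ∧ j ≫ ke = ka ≫ i' ∧ q ≫ kb = ke ≫ p' := by
  have := h.mono
  have := h'.mono
  have := h'.epi
  have := ha.mono
  have := ha.epi
  have := he.mono
  have := hb.mono
  obtain ⟨j, hj⟩ := he.exists_lift (ka ≫ i') (by simp [w₁, reassoc_of% ha.zero])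
  obtain ⟨q, hq⟩ := hb.exists_lift (ke ≫ p') (by simp [w₂, reassoc_of% he.zero])
  have : Mono j := by
    have : Mono (j ≫ ke) := by rw [hj]; infer_instance
    exact mono_of_mono j ke
  have : Epi q := by
    rw [epi_iff_surjective_up_to_refinements]
    intro T y
    obtain ⟨T₁, π₁, _, z, hz⟩ := surjective_up_to_refinements_of_epi p' (y ≫ kb)
    obtain ⟨x, hx⟩ := h.exists_lift (z ≫ e) (by
      rw [Category.assoc, ← w₂, ← reassoc_of% hz, hb.zero]; simp)
    obtain ⟨T₂, π₂, _, t, ht⟩ := surjective_up_to_refinements_of_epi a x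
    obtain ⟨s, hs⟩ := he.exists_lift (π₂ ≫ z - t ≫ i') (by
      simp [w₁, ← reassoc_of% ht, hx])
    refine ⟨T₂, π₂ ≫ π₁, inferInstance, s, ?_⟩
    rw [← cancel_mono kb]
    simp [hq, reassoc_of% hs, hz, h'.zero]
  refine ⟨j, q, mk_of_lift ?_ fun x hx => ?_, hj, hq⟩
  · rw [← cancel_mono kb]
    simp [hq, reassoc_of% hj, h'.zero]
  · obtain ⟨y, hy⟩ := h'.exists_lift (x ≫ ke) (by
      rw [Category.assoc, ← hq, reassoc_of% hx, zero_comp])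
    obtain ⟨z, hz⟩ := ha.exists_lift y (by
      rw [← cancel_mono i, Category.assoc, ← w₁, reassoc_of% hy, he.zero]; simp)
    refine ⟨z, ?_⟩
    rw [← cancel_mono ke, Category.assoc, hj, reassoc_of% hz, hy]

/-- The cokernels of a monomorphism of short exact sequences form a short exact sequence. -/
lemma exists_of_cokernel {A E B PA PE PB LA LE LB : C} {i : A ⟶ E} {p : E ⟶ B}
    {i' : PA ⟶ PE} {p' : PE ⟶ PB} {a : A ⟶ PA} {e : E ⟶ PE} {b : B ⟶ PB}
    {la : PA ⟶ LA} {le : PE ⟶ LE} {lb : PB ⟶ LB}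
    (h : IsShortExact i p) (h' : IsShortExact i' p')
    (ha : IsShortExact a la) (he : IsShortExact e le) (hb : IsShortExact b lb)
    (w₁ : i ≫ e = a ≫ i') (w₂ : p ≫ b = e ≫ p') :
    ∃ (j : LA ⟶ LE) (q : LE ⟶ LB),
      IsShortExact j q ∧ la ≫ j = i' ≫ le ∧ le ≫ q = p' ≫ lb := by
  have := h.epi
  have := h'.mono
  have := h'.epi
  have := ha.epi
  have := he.epi
  have := hb.mono
  have := hb.epi
  obtain ⟨j, hj⟩ := ha.exists_desc (i' ≫ le) (by rw [← reassoc_of% w₁, he.zero, comp_zero])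
  obtain ⟨q, hq⟩ := he.exists_desc (p' ≫ lb) (by rw [← reassoc_of% w₂, hb.zero, comp_zero])
  have : Epi q := by
    have : Epi (le ≫ q) := by rw [hq]; infer_instance
    exact epi_of_epi le q
  have : Mono j := by
    rw [Preadditive.mono_iff_cancel_zero]
    intro T x hx
    obtain ⟨T₁, π₁, _, y, hy⟩ := surjective_up_to_refinements_of_epi la x
    obtain ⟨z, hz⟩ := he.exists_lift (y ≫ i') (by
      rw [Category.assoc, ← hj, ← reassoc_of% hy, hx, comp_zero])
    obtain ⟨s, hs⟩ := h.exists_lift z (by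
      rw [← cancel_mono b, Category.assoc, w₂, reassoc_of% hz, h'.zero]; simp)
    have hsy : s ≫ a = y := by
      rw [← cancel_mono i', Category.assoc, ← w₁, reassoc_of% hs, hz]
    rw [← cancel_epi π₁, hy, ← hsy, Category.assoc, ha.zero]
    simp
  refine ⟨j, q, mk_of_desc ?_ fun x hx => ?_, hj, hq⟩
  · rw [← cancel_epi la]
    simp [hq, reassoc_of% hj, reassoc_of% h'.zero]
  · obtain ⟨y, hy⟩ := h'.exists_desc (le ≫ x) (by rw [← reassoc_of% hj, hx, comp_zero])
    obtain ⟨z, hz⟩ := hb.exists_desc y (by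
      rw [← cancel_epi p, reassoc_of% w₂, hy, reassoc_of% he.zero]; simp)
    refine ⟨z, ?_⟩
    rw [← cancel_epi le, reassoc_of% hq, hz, hy]

end IsShortExact

end ShortExact

section Syzygy

variable {C : Type u} [Category.{v} C] [Abelian C]

/-- `K` is a syzygy of `M`, and `M` a cosyzygy of `K`: there is a short exact sequence
`0 ⟶ K ⟶ P ⟶ M ⟶ 0` with `P` projective which stays exact under `Hom(-, Q)` for every
projective object `Q`. -/
def IsTotalSyzygy (K M : C) : Prop :=
  ∃ (P : C) (i : K ⟶ P) (p : P ⟶ M), Projective P ∧ IsShortExact i p ∧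
    ∀ (Q : C) [Projective Q] (g : K ⟶ Q), ∃ h : P ⟶ Q, i ≫ h = g

/-- A class of objects is closed under total syzygies if each of its members has a syzygy and a
cosyzygy which belong to it. -/
structure IsSyzygyClosed (G : ObjectProperty C) : Prop where
  syzygy : ∀ M, G M → ∃ K, G K ∧ IsTotalSyzygy K M
  cosyzygy : ∀ M, G M → ∃ L, G L ∧ IsTotalSyzygy M L

/-- The Gorenstein projective objects of an abelian category, as the largest class which is
closed under total syzygies. In this form no totally acyclic complex has to be built in order to
show that an object is Gorenstein projective. -/
def gorensteinProjective (C : Type u) [Category.{v} C] [Abelian C] : ObjectProperty C := fun M =>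
  ∃ G : ObjectProperty C, IsSyzygyClosed G ∧ G M

lemma IsSyzygyClosed.le {G : ObjectProperty C} (hG : IsSyzygyClosed G) :
    G ≤ gorensteinProjective C := fun _ hM => ⟨G, hG, hM⟩

variable (C) in
lemma isSyzygyClosed_gorensteinProjective : IsSyzygyClosed (gorensteinProjective C) where
  syzygy := by
    rintro M ⟨G, hG, hM⟩
    obtain ⟨K, hK, h⟩ := hG.syzygy M hM
    exact ⟨K, hG.le _ hK, h⟩
  cosyzygy := by
    rintro M ⟨G, hG, hM⟩
    obtain ⟨K, hK, h⟩ := hG.cosyzygy M hM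
    exact ⟨K, hG.le _ hK, h⟩

lemma IsTotalSyzygy.of_iso {K K' M M' : C} (h : IsTotalSyzygy K M) (k : K' ≅ K) (m : M ≅ M') :
    IsTotalSyzygy K' M' := by
  obtain ⟨P, i, p, hP, hip, H⟩ := h
  refine ⟨P, k.hom ≫ i, p ≫ m.hom, hP, hip.of_iso k m, fun Q _ g => ?_⟩
  obtain ⟨h, hh⟩ := H Q (k.inv ≫ g)
  exact ⟨h, by simp [hh]⟩

instance : (gorensteinProjective C).IsClosedUnderIsomorphisms where
  of_iso {M N} e hM := by
    obtain ⟨K, hK, h⟩ := (isSyzygyClosed_gorensteinProjective C).syzygy M hM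
    obtain ⟨L, hL, h'⟩ := (isSyzygyClosed_gorensteinProjective C).cosyzygy M hM
    refine IsSyzygyClosed.le (G := fun X => gorensteinProjective C X ∨ X = N)
      ⟨?_, ?_⟩ N (Or.inr rfl)
    · rintro X (hX | rfl)
      · obtain ⟨K, hK, h⟩ := (isSyzygyClosed_gorensteinProjective C).syzygy X hX
        exact ⟨K, Or.inl hK, h⟩
      · exact ⟨K, Or.inl hK, h.of_iso (Iso.refl _) e⟩
    · rintro X (hX | rfl)
      · obtain ⟨K, hK, h⟩ := (isSyzygyClosed_gorensteinProjective C).cosyzygy X hX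
        exact ⟨K, Or.inl hK, h⟩
      · exact ⟨L, Or.inl hL, h'.of_iso e.symm (Iso.refl _)⟩

lemma gorensteinProjective_of_projective (M : C) [hM : Projective M] :
    gorensteinProjective C M := by
  refine IsSyzygyClosed.le (G := fun X => Projective X) ⟨fun M hM => ?_, fun M hM => ?_⟩ M hM
  · exact ⟨0, inferInstance, M, 0, 𝟙 M, hM, .zero_id M, fun Q _ g =>
      ⟨0, (isZero_zero C).eq_of_src _ _⟩⟩
  · exact ⟨0, inferInstance, M, 𝟙 M, 0, hM, .id_zero M, fun Q _ g => ⟨g, Category.id_comp g⟩⟩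

/-- If `B` has a total syzygy, then `Ext¹(B, Q) = 0` for every projective object `Q`. -/
lemma IsTotalSyzygy.exists_extension {K A E B Q : C} (hK : IsTotalSyzygy K B) {i : A ⟶ E}
    {p : E ⟶ B} (h : IsShortExact i p) [Projective Q] (g : A ⟶ Q) : ∃ g' : E ⟶ Q, i ≫ g' = g := by
  obtain ⟨P, ι, π, _, hP, H⟩ := hK
  have := h.epi
  have := h.mono
  let l : P ⟶ E := Projective.factorThru π p
  have hl : l ≫ p = π := Projective.factorThru_comp π p
  obtain ⟨k, hk⟩ := h.exists_lift (ι ≫ l) (by rw [Category.assoc, hl, hP.zero])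
  obtain ⟨f, hf⟩ := H Q (k ≫ g)
  -- `E` is the pushout of `A` and `P` along `K`
  have : Epi (biprod.desc i l) := by
    rw [epi_iff_surjective_up_to_refinements]
    intro T y
    have := hP.epi
    obtain ⟨T₁, π₁, _, b, hb⟩ := surjective_up_to_refinements_of_epi π (y ≫ p)
    obtain ⟨a, ha⟩ := h.exists_lift (π₁ ≫ y - b ≫ l) (by simp [hl, hb])
    exact ⟨T₁, π₁, inferInstance, biprod.lift a b, by simp [ha]⟩
  obtain ⟨g', hg'⟩ := (IsShortExact.kernel_ι (biprod.desc i l)).exists_desc (biprod.desc g f) (by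
    set x := kernel.ι (biprod.desc i l) with hx
    have h0 : x ≫ biprod.fst ≫ i + x ≫ biprod.snd ≫ l = 0 := by
      have : x ≫ (biprod.fst ≫ i + biprod.snd ≫ l) = 0 := by
        rw [← biprod.desc_eq]
        exact kernel.condition _
      rwa [Preadditive.comp_add] at this
    obtain ⟨c, hc⟩ := hP.exists_lift (x ≫ biprod.snd) (by
      simpa [h.zero, hl] using h0 =≫ p)
    have h1 : x ≫ biprod.fst = -(c ≫ k) := by
      rw [← cancel_mono i, Category.assoc, Preadditive.neg_comp, Category.assoc, hk,
        reassoc_of% hc]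
      exact eq_neg_of_add_eq_zero_left h0
    have h2 : x ≫ (biprod.fst ≫ g + biprod.snd ≫ f) = 0 := by
      rw [Preadditive.comp_add, reassoc_of% h1, ← reassoc_of% hc, hf]
      simp
    rwa [← biprod.desc_eq] at h2)
  exact ⟨g', by simpa using biprod.inl ≫= hg'⟩

/-- The horseshoe lemma: an extension of objects with total syzygies has a total syzygy, which is
an extension of theirs. -/
lemma IsTotalSyzygy.exists_horseshoe {KA KB A E B : C} (hA : IsTotalSyzygy KA A)
    (hB : IsTotalSyzygy KB B) {i : A ⟶ E} {p : E ⟶ B} (h : IsShortExact i p) :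
    ∃ (KE : C) (j : KA ⟶ KE) (q : KE ⟶ KB), IsShortExact j q ∧ IsTotalSyzygy KE E := by
  obtain ⟨PA, ka, a, _, hPA, HA⟩ := hA
  obtain ⟨PB, kb, b, _, hPB, HB⟩ := hB
  have := h.epi
  have := hPA.epi
  have := hPB.epi
  let l : PB ⟶ E := Projective.factorThru b p
  have hl : l ≫ p = b := Projective.factorThru_comp b p
  let e : PA ⊞ PB ⟶ E := biprod.desc (a ≫ i) l
  have : Epi e := by
    rw [epi_iff_surjective_up_to_refinements]
    intro T y
    obtain ⟨T₁, π₁, _, z, hz⟩ := surjective_up_to_refinements_of_epi b (y ≫ p)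
    obtain ⟨x, hx⟩ := h.exists_lift (π₁ ≫ y - z ≫ l) (by simp [hl, hz])
    obtain ⟨T₂, π₂, _, t, ht⟩ := surjective_up_to_refinements_of_epi a x
    exact ⟨T₂, π₂ ≫ π₁, inferInstance, biprod.lift t (π₂ ≫ z), by
      simp [e, ← reassoc_of% ht, hx]⟩
  have he := IsShortExact.kernel_ι e
  obtain ⟨j, q, hjq, hj, hq⟩ := IsShortExact.exists_of_kernel h (.biprod_inl_snd PA PB) hPA he hPB
    (by simp [e]) (by ext <;> simp [e, hl, h.zero])
  refine ⟨kernel e, j, q, hjq, PA ⊞ PB, kernel.ι e, e, inferInstance, he, fun Q _ g => ?_⟩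
  obtain ⟨f, hf⟩ := HA Q (j ≫ g)
  obtain ⟨g', hg'⟩ := hjq.exists_desc (g - kernel.ι e ≫ biprod.fst ≫ f) (by
    simp [reassoc_of% hj, hf])
  obtain ⟨f', hf'⟩ := HB Q g'
  refine ⟨biprod.fst ≫ f + biprod.snd ≫ f', ?_⟩
  rw [Preadditive.comp_add, ← reassoc_of% hq, hf', hg']
  abel

/-- The horseshoe lemma for cosyzygies. The syzygy of `B` is needed to extend the morphism from `A`
to a projective object to `E`. -/
lemma IsTotalSyzygy.exists_cohorseshoe {K A E B LA LB : C} (hA : IsTotalSyzygy A LA)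
    (hB : IsTotalSyzygy B LB) (hK : IsTotalSyzygy K B) {i : A ⟶ E} {p : E ⟶ B}
    (h : IsShortExact i p) :
    ∃ (LE : C) (j : LA ⟶ LE) (q : LE ⟶ LB), IsShortExact j q ∧ IsTotalSyzygy E LE := by
  obtain ⟨PA, a, la, _, hPA, HA⟩ := hA
  obtain ⟨PB, b, lb, _, hPB, HB⟩ := hB
  have := h.mono
  have := hPA.mono
  have := hPB.mono
  obtain ⟨r, hr⟩ := hK.exists_extension h a
  let e : E ⟶ PA ⊞ PB := biprod.lift r (p ≫ b)
  have : Mono e := by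
    rw [Preadditive.mono_iff_cancel_zero]
    intro T x hx
    obtain ⟨y, hy⟩ := h.exists_lift x (by
      rw [← cancel_mono b]; simpa [e] using hx =≫ biprod.snd)
    have h0 : x ≫ r = 0 := by simpa [e] using hx =≫ biprod.fst
    have : y = 0 := by
      rw [← cancel_mono a, ← hr, reassoc_of% hy, h0, zero_comp]
    rw [← hy, this, zero_comp]
  have he := IsShortExact.cokernel_π e
  obtain ⟨j, q, hjq, hj, hq⟩ := IsShortExact.exists_of_cokernel h (.biprod_inl_snd PA PB) hPA he hPB
    (by ext <;> simp [e, hr, reassoc_of% h.zero]) (by simp [e])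
  refine ⟨cokernel e, j, q, hjq, PA ⊞ PB, e, cokernel.π e, inferInstance, he, fun Q _ g => ?_⟩
  obtain ⟨f, hf⟩ := HA Q (i ≫ g)
  obtain ⟨g', hg'⟩ := h.exists_desc (g - r ≫ f) (by simp [reassoc_of% hr, hf])
  obtain ⟨f', hf'⟩ := HB Q g'
  refine ⟨biprod.desc f f', ?_⟩
  simp [e, hf', hg']

/-- The Gorenstein projective objects are closed under extensions. -/
lemma gorensteinProjective_of_extension {A E B : C} {i : A ⟶ E} {p : E ⟶ B}
    (h : IsShortExact i p) (hA : gorensteinProjective C A) (hB : gorensteinProjective C B) :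
    gorensteinProjective C E := by
  refine IsSyzygyClosed.le (G := fun E => ∃ (A B : C) (i : A ⟶ E) (p : E ⟶ B), IsShortExact i p ∧
    gorensteinProjective C A ∧ gorensteinProjective C B) ⟨?_, ?_⟩ E ⟨A, B, i, p, h, hA, hB⟩
  · rintro E ⟨A, B, i, p, h, hA, hB⟩
    obtain ⟨KA, hKA, hA⟩ := (isSyzygyClosed_gorensteinProjective C).syzygy A hA
    obtain ⟨KB, hKB, hB⟩ := (isSyzygyClosed_gorensteinProjective C).syzygy B hB
    obtain ⟨KE, j, q, hjq, hE⟩ := hA.exists_horseshoe hB h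
    exact ⟨KE, ⟨KA, KB, j, q, hjq, hKA, hKB⟩, hE⟩
  · rintro E ⟨A, B, i, p, h, hA, hB⟩
    obtain ⟨LA, hLA, hA⟩ := (isSyzygyClosed_gorensteinProjective C).cosyzygy A hA
    obtain ⟨KB, -, hB'⟩ := (isSyzygyClosed_gorensteinProjective C).syzygy B hB
    obtain ⟨LB, hLB, hB⟩ := (isSyzygyClosed_gorensteinProjective C).cosyzygy B hB
    obtain ⟨LE, j, q, hjq, hE⟩ := hA.exists_cohorseshoe hB hB' h
    exact ⟨LE, ⟨LA, LB, j, q, hjq, hLA, hLB⟩, hE⟩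

/-- If `M ⊞ M'` is Gorenstein projective, then so is `M`. -/
lemma gorensteinProjective_of_biprod {M M' : C} (h : gorensteinProjective C (M ⊞ M')) :
    gorensteinProjective C M := by
  refine IsSyzygyClosed.le (G := fun M => ∃ M' : C, gorensteinProjective C (M ⊞ M'))
    ⟨?_, ?_⟩ M ⟨M', h⟩
  · rintro M ⟨M', hN⟩
    obtain ⟨KN, hKN, hKN'⟩ := (isSyzygyClosed_gorensteinProjective C).syzygy _ hN
    obtain ⟨P, i, p, hP, h, H⟩ := id hKN'
    have := h.epi
    have hs := IsShortExact.kernel_ι (p ≫ biprod.fst)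
    obtain ⟨j, hj⟩ := hs.exists_lift i (by simp [reassoc_of% h.zero])
    have := h.mono
    have : Mono j := by
      have : Mono (j ≫ kernel.ι (p ≫ biprod.fst)) := by rw [hj]; infer_instance
      exact mono_of_mono j (kernel.ι (p ≫ biprod.fst))
    -- the kernel `K` of `P ⟶ M` is an extension of `M'` by the syzygy of `M ⊞ M'`
    have hq : Epi (kernel.ι (p ≫ biprod.fst) ≫ p ≫ biprod.snd) := by
      rw [epi_iff_surjective_up_to_refinements]
      intro T y
      obtain ⟨T₁, π₁, _, z, hz⟩ := surjective_up_to_refinements_of_epi p (y ≫ biprod.inr)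
      obtain ⟨x, hx⟩ := hs.exists_lift z (by
        rw [← reassoc_of% hz, biprod.inr_fst]; simp)
      exact ⟨T₁, π₁, inferInstance, x, by rw [reassoc_of% hx, ← reassoc_of% hz]; simp⟩
    have hK : IsShortExact j (kernel.ι (p ≫ biprod.fst) ≫ p ≫ biprod.snd) :=
      .mk_of_lift (by rw [reassoc_of% hj, reassoc_of% h.zero, zero_comp]) fun x hx => by
        obtain ⟨y, hy⟩ := h.exists_lift (x ≫ kernel.ι (p ≫ biprod.fst)) (by
          ext
          · simp [kernel.condition (p ≫ biprod.fst)]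
          · simpa using hx)
        exact ⟨y, by rw [← cancel_mono (kernel.ι (p ≫ biprod.fst)), Category.assoc, hj, hy]⟩
    refine ⟨kernel (p ≫ biprod.fst), ⟨M, gorensteinProjective_of_extension (hK.biprod_right M) hKN
      ((gorensteinProjective C).prop_of_iso (biprod.braiding M M') hN)⟩, P, _, _, hP, hs,
      fun Q _ g => ?_⟩
    obtain ⟨g', hg'⟩ := hKN'.exists_extension (hs.biprod_right M') g
    exact ⟨biprod.inl ≫ g', by simpa using hg'⟩
  · rintro M ⟨M', hN⟩
    obtain ⟨LN, hLN, P, i, p, hP, h, H⟩ :=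
      (isSyzygyClosed_gorensteinProjective C).cosyzygy _ hN
    have := h.epi
    have := h.mono
    have hs := IsShortExact.cokernel_π (biprod.inl ≫ i)
    obtain ⟨q, hq⟩ := hs.exists_desc p (by rw [Category.assoc, h.zero, comp_zero])
    have : Epi q := by
      have : Epi (cokernel.π (biprod.inl ≫ i) ≫ q) := by rw [hq]; infer_instance
      exact epi_of_epi (cokernel.π (biprod.inl ≫ i)) q
    -- the cokernel `L` of `M ⟶ P` is an extension of the cosyzygy of `M ⊞ M'` by `M'`
    have hj : Mono (biprod.inr ≫ i ≫ cokernel.π (biprod.inl ≫ i)) := by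
      rw [Preadditive.mono_iff_cancel_zero]
      intro T x hx
      obtain ⟨y, hy⟩ := hs.exists_lift (x ≫ biprod.inr ≫ i) (by simpa using hx)
      have h0 : y ≫ biprod.inl = x ≫ biprod.inr := by
        rw [← cancel_mono i]; simpa using hy
      simpa using (h0 =≫ biprod.snd).symm
    have hL : IsShortExact (biprod.inr ≫ i ≫ cokernel.π (biprod.inl ≫ i)) q :=
      .mk_of_desc (by simp [hq, h.zero]) fun x hx => by
        obtain ⟨y, hy⟩ := h.exists_desc (cokernel.π (biprod.inl ≫ i) ≫ x) (by
          ext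
          · have := cokernel.condition_assoc (biprod.inl ≫ i) x
            simp only [Category.assoc, zero_comp] at this
            simpa only [comp_zero] using this
          · simpa using hx)
        exact ⟨y, by rw [← cancel_epi (cokernel.π (biprod.inl ≫ i)), reassoc_of% hq, hy]⟩
    refine ⟨cokernel (biprod.inl ≫ i), ⟨M, gorensteinProjective_of_extension (hL.biprod_left M)
      ((gorensteinProjective C).prop_of_iso (biprod.braiding M M') hN) hLN⟩, P, _, _, hP, hs,
      fun Q _ g => ?_⟩
    obtain ⟨g', hg'⟩ := H Q (biprod.fst ≫ g)
    exact ⟨g', by rw [Category.assoc, hg', biprod.inl_fst_assoc]⟩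

lemma gorensteinProjective_of_retract {M N : C} (r : Retract M N)
    (hN : gorensteinProjective C N) : gorensteinProjective C M := by
  let f : M ⊞ kernel r.r ⟶ N := biprod.desc r.i (kernel.ι r.r)
  let g : N ⟶ M ⊞ kernel r.r := biprod.lift r.r (kernel.lift r.r (𝟙 N - r.r ≫ r.i) (by simp))
  refine gorensteinProjective_of_biprod ((gorensteinProjective C).prop_of_iso
    (X := N) (Y := M ⊞ kernel r.r) ⟨g, f, ?_, ?_⟩ hN)
  · simp [f, g]
  · ext <;> simp [f, g]

/-- An object is Gorenstein projective if its identity factors through a Gorenstein projective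
object up to a morphism which factors through a projective object. -/
lemma gorensteinProjective_of_stable_retract {M N P : C} [Projective P]
    (hN : gorensteinProjective C N) (a : M ⟶ N) (b : N ⟶ M) (c : M ⟶ P) (d : P ⟶ M)
    (h : a ≫ b + c ≫ d = 𝟙 M) : gorensteinProjective C M :=
  gorensteinProjective_of_retract ⟨biprod.lift a c, biprod.desc b d, by simpa using h⟩
    (gorensteinProjective_of_extension (.biprod_inl_snd N P) hN
      (gorensteinProjective_of_projective P))

end Syzygy

end GorensteinProjective

/-! ### Syzygies in the derived category -/

namespace GorensteinProjective

open scoped ZeroObject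
open DerivedCategory DerivedCategory.TStructure

variable {C : Type u} [Category.{v} C] [Abelian C] [HasDerivedCategory.{w} C]

section SingleTriangle

/-- A short exact sequence of objects of `C` gives a distinguished triangle of stalk complexes. -/
lemma IsShortExact.exists_distinguished {A E B : C} {i : A ⟶ E} {p : E ⟶ B}
    (h : IsShortExact i p) (m : ℤ) :
    ∃ δ : (singleFunctor C m).obj B ⟶ ((singleFunctor C m).obj A)⟦(1 : ℤ)⟧,
      Triangle.mk ((singleFunctor C m).map i) ((singleFunctor C m).map p) δ ∈
        distTriang (DerivedCategory C) := by
  obtain ⟨w, h⟩ := h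
  exact ⟨_, triangleOfSES_distinguished
    (h.map_of_exact (HomologicalComplex.single C (ComplexShape.up ℤ) m))⟩

lemma singleFunctor_map_comp_map_eq_zero (m : ℤ) {A B D : C} {f : A ⟶ B} {g : B ⟶ D}
    (h : f ≫ g = 0) : (singleFunctor C m).map f ≫ (singleFunctor C m).map g = 0 := by
  rw [← Functor.map_comp, h, Functor.map_zero]

/-- A distinguished triangle of stalk complexes in a fixed degree comes from a short exact
sequence. -/
lemma isShortExact_of_distinguished {A E B : C} {i : A ⟶ E} {p : E ⟶ B} {m : ℤ}
    {δ : (singleFunctor C m).obj B ⟶ ((singleFunctor C m).obj A)⟦(1 : ℤ)⟧}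
    (h : Triangle.mk ((singleFunctor C m).map i) ((singleFunctor C m).map p) δ ∈
        distTriang (DerivedCategory C)) : IsShortExact i p := by
  have : Mono i := by
    rw [Preadditive.mono_iff_cancel_zero]
    intro T x hx
    apply (singleFunctor C m).map_injective
    obtain ⟨y, hy⟩ := Triangle.coyoneda_exact₂ _ (inv_rot_of_distTriang _ h)
      ((singleFunctor C m).map x) (singleFunctor_map_comp_map_eq_zero m hx)
    have hGE := t.isGE_shift ((singleFunctor C m).obj B) m (-1) (m + 1)
    have hy0 : y = 0 := t.zero (Y := ((singleFunctor C m).obj B)⟦(-1 : ℤ)⟧) y m (m + 1)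
    rw [hy, hy0, zero_comp, Functor.map_zero]
    rfl
  have : Epi p := by
    rw [Preadditive.epi_iff_cancel_zero]
    intro T x hx
    apply (singleFunctor C m).map_injective
    obtain ⟨y, hy⟩ := Triangle.yoneda_exact₃ _ h
      ((singleFunctor C m).map x) (singleFunctor_map_comp_map_eq_zero m hx)
    have hLE := t.isLE_shift ((singleFunctor C m).obj A) m 1 (m - 1)
    have hy0 : y = 0 := t.zero (X := ((singleFunctor C m).obj A)⟦(1 : ℤ)⟧) y (m - 1) m
    rw [hy, hy0, comp_zero, Functor.map_zero]
    rfl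
  refine .mk_of_lift ?_ fun x hx => ?_
  · apply (singleFunctor C m).map_injective
    rw [Functor.map_comp, Functor.map_zero]
    exact comp_distTriang_mor_zero₁₂ _ h
  · obtain ⟨y, hy⟩ := Triangle.coyoneda_exact₂ _ h ((singleFunctor C m).map x)
      (singleFunctor_map_comp_map_eq_zero m hx)
    obtain ⟨y, rfl⟩ := (singleFunctor C m).map_surjective y
    refine ⟨y, (singleFunctor C m).map_injective ?_⟩
    rw [Functor.map_comp]
    exact hy.symm

/-- Projective objects placed in degree `m` are left orthogonal to the objects concentrated in
degrees `< m`. -/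
lemma eq_zero_of_projective {P : C} [Projective P] {m : ℤ} {T : DerivedCategory C}
    [hT : T.IsLE (m - 1)] (f : (singleFunctor C m).obj P ⟶ T) : f = 0 := by
  obtain ⟨K, hK, ⟨e⟩⟩ := exists_iso_Q_obj_of_isLE T (m - 1)
  rw [← cancel_mono e.hom, zero_comp]
  let S : CochainComplex C ℤ := (HomologicalComplex.single C (ComplexShape.up ℤ) m).obj P
  have : ∀ i, Projective (S.X i) := fun i => by
    by_cases hi : i = m
    · subst hi
      exact Projective.of_iso (HomologicalComplex.singleObjXSelf (ComplexShape.up ℤ) i P).symm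
        inferInstance
    · exact (HomologicalComplex.isZero_single_obj_X (ComplexShape.up ℤ) m P i hi).projective
  have : CochainComplex.IsStrictlyLE S m := by
    dsimp [S]; infer_instance
  have : S.IsKProjective := CochainComplex.isKProjective_of_projective S m
  obtain ⟨g, hg⟩ := (CochainComplex.IsKProjective.Qh_map_bijective S
    ((HomotopyCategory.quotient C (.up ℤ)).obj K)).surjective (f ≫ e.hom)
  obtain ⟨g, rfl⟩ := (HomotopyCategory.quotient C (.up ℤ)).map_surjective g
  have hg0 : g = 0 := HomologicalComplex.from_single_hom_ext
    ((K.isZero_of_isStrictlyLE (m - 1) m).eq_of_tgt _ _)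
  refine hg.symm.trans ?_
  rw [hg0, Functor.map_zero, Functor.map_zero]
  rfl

end SingleTriangle

section Approximation

/-- A morphism `f : X ⟶ Y` in the derived category is a left approximation below `m` if
`Hom(f, T)` is surjective for `T` in degrees `≤ m` and injective for `T` in degrees `≤ m - 1`.
Equivalently, the fibre of `f` is left orthogonal to the objects in degrees `≤ m`. If
`Y` is the stalk complex of `M` in degree `m`, this says that `M` is the syzygy of `X`
in degree `m`, i.e. the cokernel of `P^{m-1} ⟶ P^m` for a projective resolution `P` of `X`. -/
structure IsLeftApprox (m : ℤ) {X Y : DerivedCategory C} (f : X ⟶ Y) : Prop where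
  surjective : ∀ (T : DerivedCategory C) [T.IsLE m] (g : X ⟶ T), ∃ h : Y ⟶ T, f ≫ h = g
  injective : ∀ (T : DerivedCategory C) [T.IsLE (m - 1)] (h : Y ⟶ T), f ≫ h = 0 → h = 0

namespace IsLeftApprox

variable {m : ℤ} {X Y Z : DerivedCategory C}

lemma of_isIso (m : ℤ) (f : X ⟶ Y) [IsIso f] : IsLeftApprox m f where
  surjective _ _ g := ⟨inv f ≫ g, by simp⟩
  injective _ _ h hh := by simpa using inv f ≫= hh

lemma of_le {f : X ⟶ Y} (hf : IsLeftApprox m f) {m' : ℤ} (h : m' ≤ m) : IsLeftApprox m' f where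
  surjective T _ g := by
    have := t.isLE_of_le T m' m
    exact hf.surjective T g
  injective T _ g hg := by
    have := t.isLE_of_le T (m' - 1) (m - 1)
    exact hf.injective T g hg

lemma comp {f : X ⟶ Y} {g : Y ⟶ Z} (hf : IsLeftApprox m f) (hg : IsLeftApprox m g) :
    IsLeftApprox m (f ≫ g) where
  surjective T _ x := by
    obtain ⟨y, hy⟩ := hf.surjective T x
    obtain ⟨z, hz⟩ := hg.surjective T y
    exact ⟨z, by rw [Category.assoc, hz, hy]⟩
  injective T _ z hz := hg.injective T z (hf.injective T _ (by rw [← Category.assoc, hz]))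

lemma shift {f : X ⟶ Y} (hf : IsLeftApprox m f) (a m' : ℤ) (h : a + m' = m) :
    IsLeftApprox m' (f⟦a⟧') where
  surjective T _ g := by
    have := t.isLE_shift T m' (-a) m
    let e : (T⟦-a⟧)⟦a⟧ ≅ T := (shiftFunctorCompIsoId (DerivedCategory C) (-a) a (by simp)).app T
    obtain ⟨x, hx⟩ := (shiftFunctor (DerivedCategory C) a).map_surjective (g ≫ e.inv)
    obtain ⟨y, rfl⟩ := hf.surjective (T⟦-a⟧) x
    refine ⟨y⟦a⟧' ≫ e.hom, ?_⟩
    rw [← Functor.map_comp_assoc, hx, Category.assoc, e.inv_hom_id, Category.comp_id]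
  injective T _ y hy := by
    have := t.isLE_shift T (m' - 1) (-a) (m - 1)
    let e : (T⟦-a⟧)⟦a⟧ ≅ T := (shiftFunctorCompIsoId (DerivedCategory C) (-a) a (by simp)).app T
    obtain ⟨x, hx⟩ := (shiftFunctor (DerivedCategory C) a).map_surjective (y ≫ e.inv)
    have hx0 : x = 0 := by
      apply hf.injective (T⟦-a⟧)
      apply (shiftFunctor (DerivedCategory C) a).map_injective
      rw [Functor.map_comp, hx, reassoc_of% hy, Functor.map_zero, zero_comp]
    rw [← cancel_mono e.inv, ← hx, hx0, Functor.map_zero, zero_comp]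

lemma of_distinguished {T : Triangle (DerivedCategory C)} (hT : T ∈ distTriang _)
    (h : ∀ (Z : DerivedCategory C) [Z.IsLE m] (f : T.obj₁ ⟶ Z), f = 0) :
    IsLeftApprox m T.mor₂ where
  surjective Z _ g := by
    obtain ⟨y, hy⟩ := Triangle.yoneda_exact₂ _ hT g (h _ _)
    exact ⟨y, hy.symm⟩
  injective Z _ g hg := by
    obtain ⟨y, rfl⟩ := Triangle.yoneda_exact₃ _ hT g hg
    have := t.isLE_shift Z (m - 1) (-1) m
    have hy : y = 0 := by
      apply (shiftFunctor (DerivedCategory C) (-1 : ℤ)).map_injective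
      rw [← cancel_epi ((shiftFunctorCompIsoId (DerivedCategory C) (1 : ℤ) (-1) (by simp)).inv.app
        T.obj₁)]
      rw [Functor.map_zero, comp_zero]
      exact h _ _
    rw [hy, comp_zero]

/-- Left approximations can be glued along distinguished triangles. -/
lemma exists_of_extension {T : Triangle (DerivedCategory C)} (hT : T ∈ distTriang _)
    {M N : DerivedCategory C} [M.IsLE m] {f : T.obj₁ ⟶ M} {g : T.obj₃ ⟶ N}
    (hf : IsLeftApprox m f) (hg : IsLeftApprox m g) :
    ∃ (W : DerivedCategory C) (i : M ⟶ W) (j : W ⟶ N) (δ : N ⟶ M⟦(1 : ℤ)⟧) (c : T.obj₂ ⟶ W),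
      Triangle.mk i j δ ∈ distTriang _ ∧ IsLeftApprox m c := by
  have hM := t.isLE_shift M m 1 (m - 1)
  have hM' := t.isLE_of_le (M⟦(1 : ℤ)⟧) (m - 1) m
  have hf₁ := hf.shift 1 (m - 1) (by lia)
  obtain ⟨δ, hδ⟩ := hg.surjective (M⟦(1 : ℤ)⟧) (T.mor₃ ≫ f⟦(1 : ℤ)⟧')
  obtain ⟨W, i, j, hW⟩ := distinguished_cocone_triangle₂ δ
  obtain ⟨c, hc₁, hc₂⟩ : ∃ c : T.obj₂ ⟶ W, T.mor₁ ≫ c = f ≫ i ∧ T.mor₂ ≫ g = c ≫ j :=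
    complete_distinguished_triangle_morphism₂ T (Triangle.mk i j δ) hT hW f g hδ.symm
  refine ⟨W, i, j, δ, c, hW, ?_, ?_⟩
  · intro Z _ x
    obtain ⟨y, hy⟩ := hf.surjective Z (T.mor₁ ≫ x)
    have := t.isLE_shift Z m 1 (m - 1)
    have hδy : δ ≫ y⟦(1 : ℤ)⟧' = 0 := hg.injective (Z⟦(1 : ℤ)⟧) _ (by
      rw [reassoc_of% hδ, ← Functor.map_comp, hy, Functor.map_comp,
        comp_distTriang_mor_zero₃₁_assoc _ hT, zero_comp])
    obtain ⟨s, hs⟩ : ∃ s : W⟦(1 : ℤ)⟧ ⟶ Z⟦(1 : ℤ)⟧, y⟦(1 : ℤ)⟧' = (-i⟦(1 : ℤ)⟧') ≫ s :=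
      Triangle.yoneda_exact₃ _ (rot_of_distTriang _ hW) (y⟦(1 : ℤ)⟧') hδy
    obtain ⟨s, rfl⟩ := (shiftFunctor (DerivedCategory C) (1 : ℤ)).map_surjective s
    have hy' : y = i ≫ (-s) := by
      apply (shiftFunctor (DerivedCategory C) (1 : ℤ)).map_injective
      rw [hs]
      simp
    obtain ⟨k, hk⟩ := Triangle.yoneda_exact₂ _ hT (x - c ≫ (-s)) (by
      rw [Preadditive.comp_sub, reassoc_of% hc₁, ← hy', hy, sub_self])
    obtain ⟨k', rfl⟩ := hg.surjective Z k
    refine ⟨-s + j ≫ k', ?_⟩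
    rw [Preadditive.comp_add, ← reassoc_of% hc₂, ← hk]
    abel
  · intro Z _ x hx
    have hix : i ≫ x = 0 := hf.injective Z _ (by rw [← reassoc_of% hc₁, hx, comp_zero])
    obtain ⟨y, rfl⟩ : ∃ y : N ⟶ Z, x = j ≫ y := Triangle.yoneda_exact₂ _ hW x hix
    obtain ⟨l, hl⟩ := Triangle.yoneda_exact₃ _ hT (g ≫ y) (by
      rw [reassoc_of% hc₂, hx])
    obtain ⟨l', rfl⟩ := hf₁.surjective Z l
    have : y = δ ≫ l' := by
      rw [← sub_eq_zero]
      apply hg.injective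
      rw [Preadditive.comp_sub, hl, reassoc_of% hδ, sub_self]
    have hjδ : j ≫ δ = 0 := comp_distTriang_mor_zero₂₃ _ hW
    rw [this, reassoc_of% hjδ, zero_comp]

end IsLeftApprox

/-- The map `M[-m] ⟶ K[-(m-1)]` given by a syzygy `K` of `M` is a left approximation
below `m - 1`. -/
lemma IsShortExact.exists_isLeftApprox {K P M : C} [Projective P] {i : K ⟶ P} {p : P ⟶ M}
    (h : IsShortExact i p) (m : ℤ) :
    ∃ f : (singleFunctor C m).obj M ⟶ (singleFunctor C (m - 1)).obj K,
      IsLeftApprox (m - 1) f := by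
  obtain ⟨δ, hδ⟩ := h.exists_distinguished m
  have : IsLeftApprox (m - 1) δ := IsLeftApprox.of_distinguished (rot_of_distTriang _ hδ)
    fun Z _ f => eq_zero_of_projective f
  exact ⟨_, this.comp (.of_isIso _ (((singleFunctors C).shiftIso 1 (m - 1) m (by lia)).hom.app K))⟩

/-- Schanuel's lemma for left approximations: if `X` is a retract of `Y`, then the syzygy of `X`
is a retract of the syzygy of `Y` up to projective objects. -/
lemma exists_stable_retract [EnoughProjectives C] {m : ℤ} {X Y : DerivedCategory C}
    (r : Retract X Y) {M N : C} {f : X ⟶ (singleFunctor C m).obj M}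
    {g : Y ⟶ (singleFunctor C m).obj N} (hf : IsLeftApprox m f) (hg : IsLeftApprox m g) :
    ∃ (P : C) (_ : Projective P) (a : M ⟶ N) (b : N ⟶ M) (c : M ⟶ P) (d : P ⟶ M),
      a ≫ b + c ≫ d = 𝟙 M := by
  obtain ⟨a, ha⟩ := hf.surjective _ (r.i ≫ g)
  obtain ⟨b, hb⟩ := hg.surjective _ (r.r ≫ f)
  obtain ⟨a, rfl⟩ := (singleFunctor C m).map_surjective a
  obtain ⟨b, rfl⟩ := (singleFunctor C m).map_surjective b
  obtain ⟨δ, hδ⟩ := (IsShortExact.kernel_ι (Projective.π M)).exists_distinguished m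
  have hK := t.isLE_shift ((singleFunctor C m).obj (kernel (Projective.π M))) m 1 (m - 1)
  obtain ⟨c, hc⟩ := Triangle.coyoneda_exact₃ _ hδ ((singleFunctor C m).map (𝟙 M - a ≫ b))
    (hf.injective (((singleFunctor C m).obj (kernel (Projective.π M)))⟦(1 : ℤ)⟧) _ (by
      have : f ≫ (singleFunctor C m).map (𝟙 M - a ≫ b) = 0 := by
        rw [Functor.map_sub, Functor.map_comp, Preadditive.comp_sub, reassoc_of% ha, hb]
        simp
      exact (reassoc_of% this) _ |>.trans zero_comp))
  obtain ⟨c, rfl⟩ := (singleFunctor C m).map_surjective c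
  refine ⟨Projective.over M, inferInstance, a, b, c, Projective.π M, ?_⟩
  have : 𝟙 M - a ≫ b = c ≫ Projective.π M :=
    (singleFunctor C m).map_injective (by rw [hc, Functor.map_comp]; rfl)
  rw [← this]
  abel

end Approximation

section Model

/-- A morphism in the derived category from a complex in degrees `≤ n` to a stalk complex in degree
`n` is given by a morphism of complexes. -/
lemma exists_Q_map_eq_to_single {K : CochainComplex C ℤ} {n : ℤ} [K.IsStrictlyLE n] {P : C}
    (f : Q.obj K ⟶ (singleFunctor C n).obj P) :
    ∃ g : K ⟶ (HomologicalComplex.single C (ComplexShape.up ℤ) n).obj P, Q.map g = f := by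
  obtain ⟨L, _, _, g, s, hs, hf⟩ : ∃ (L : CochainComplex C ℤ) (_ : L.IsStrictlyGE n)
      (_ : L.IsStrictlyLE n) (g : K ⟶ L)
      (s : (HomologicalComplex.single C (ComplexShape.up ℤ) n).obj P ⟶ L) (_ : IsIso (Q.map s)),
        f = Q.map g ≫ inv (Q.map s) :=
    left_fac_of_isStrictlyLE_of_isStrictlyGE (C := C)
      (Y := (HomologicalComplex.single C (ComplexShape.up ℤ) n).obj P) n n f
  obtain ⟨N, ⟨e⟩⟩ := CochainComplex.exists_iso_single L n
  obtain ⟨σ, hσ⟩ := (HomologicalComplex.single C (ComplexShape.up ℤ) n).map_surjective (s ≫ e.hom)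
  have : IsIso (Q.map (s ≫ e.hom)) := by
    rw [Functor.map_comp]
    infer_instance
  have : IsIso ((singleFunctor C n).map σ) := by
    change IsIso (Q.map ((HomologicalComplex.single C (ComplexShape.up ℤ) n).map σ))
    rwa [hσ]
  have : IsIso σ := isIso_of_reflects_iso σ (singleFunctor C n)
  have hs' : s = (HomologicalComplex.single C (ComplexShape.up ℤ) n).map σ ≫ e.inv := by
    rw [hσ, Category.assoc, e.hom_inv_id, Category.comp_id]
  have : IsIso s := by
    rw [hs']
    infer_instance
  exact ⟨g ≫ inv s, by rw [hf, Functor.map_comp, Functor.map_inv]⟩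

end Model

end GorensteinProjective

/-! ### Replacement by a complex of projective objects in all degrees but the lowest -/

namespace GorensteinProjective

open scoped ZeroObject
open DerivedCategory DerivedCategory.TStructure

variable {C : Type u} [Category.{v} C] [Abelian C]

section Model

section MappingCocone

variable {K : CochainComplex C ℤ} {n : ℤ} {P : C}
  (φ : K ⟶ (HomologicalComplex.single C (ComplexShape.up ℤ) n).obj P)

open CochainComplex in
/-- Away from degree `n + 1`, the mapping cocone of a morphism to a stalk complex in degree `n` has
the same terms as the source. -/
noncomputable def mappingCoconeXIso (i : ℤ) (hi : i ≠ n + 1) :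
    (mappingCocone φ).X i ≅ K.X i where
  hom := (mappingCocone.fst φ).f i
  inv := (mappingCocone.inl φ).v i i (add_zero i)
  hom_inv_id := by
    rw [← mappingCocone.id_X φ i (i + -1) rfl,
      (HomologicalComplex.isZero_single_obj_X (ComplexShape.up ℤ) n P (i + -1)
        (by lia)).eq_of_tgt ((mappingCocone.snd φ).v i (i + -1) rfl) 0]
    simp
  inv_hom_id := mappingCocone.inl_v_fst_f φ i

open CochainComplex in
lemma projective_mappingCocone_X (i : ℤ) [hP : Projective P] (hK : Projective (K.X i)) :
    Projective ((mappingCocone φ).X i) := by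
  have : Projective (((HomologicalComplex.single C (ComplexShape.up ℤ) n).obj P).X (i + -1)) := by
    by_cases hi : i + -1 = n
    · subst hi
      exact Projective.of_iso (HomologicalComplex.singleObjXSelf (ComplexShape.up ℤ) _ P).symm hP
    · exact (HomologicalComplex.isZero_single_obj_X (ComplexShape.up ℤ) n P _ hi).projective
  let r : Retract ((mappingCocone φ).X i)
      (K.X i ⊞ ((HomologicalComplex.single C (ComplexShape.up ℤ) n).obj P).X (i + -1)) :=
    { i := biprod.lift ((mappingCocone.fst φ).f i) ((mappingCocone.snd φ).v i (i + -1) rfl)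
      r := biprod.desc ((mappingCocone.inl φ).v i i (add_zero i))
        ((mappingCocone.inr φ).1.v (i + -1) i (by lia))
      retract := by simpa using mappingCocone.id_X φ i (i + -1) rfl }
  exact r.projective

end MappingCocone

variable [HasDerivedCategory.{w} C]

/-- In an abelian category with enough projectives, an object in degrees `[m, m + n]` is isomorphic
to a complex in these degrees whose terms are projective, except possibly in the lowest
degree `m`, where the term is the syzygy of the object. -/
lemma exists_model [EnoughProjectives C] (m : ℤ) (n : ℕ) (X : DerivedCategory C)
    [X.IsGE m] [X.IsLE (m + n)] :
    ∃ K : CochainComplex C ℤ, K.IsStrictlyGE m ∧ K.IsStrictlyLE (m + n) ∧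
      (∀ i, m < i → Projective (K.X i)) ∧ Nonempty (X ≅ Q.obj K) ∧
      ∃ f : X ⟶ (singleFunctor C m).obj (K.X m), IsLeftApprox m f := by
  induction n generalizing X with
  | zero =>
    have : X.IsLE m := by simpa using (inferInstance : X.IsLE (m + (0 : ℕ)))
    obtain ⟨M, ⟨e⟩⟩ := exists_iso_singleFunctor_obj_of_isGE_of_isLE X m
    refine ⟨(HomologicalComplex.single C (ComplexShape.up ℤ) m).obj M, ?_, ?_, fun i hi => ?_,
      ⟨e⟩, e.hom ≫ (singleFunctor C m).map
        (HomologicalComplex.singleObjXSelf (ComplexShape.up ℤ) m M).inv, .of_isIso m _⟩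
    · infer_instance
    · simpa using (inferInstance : CochainComplex.IsStrictlyLE
        ((HomologicalComplex.single C (ComplexShape.up ℤ) m).obj M) m)
    · exact (HomologicalComplex.isZero_single_obj_X (ComplexShape.up ℤ) m M i
        (by lia)).projective
  | succ n ih =>
    have hXb : t.IsLE X (m + n + 1) := by
      have : X.IsLE (m + ((n + 1 : ℕ) : ℤ)) := inferInstance
      rwa [Nat.cast_add, Nat.cast_one, ← add_assoc] at this
    -- `H` is the top cohomology of `X`, and `P` a projective object which maps onto it; `X` is the
    -- cocone of a morphism from `Y`, in degrees `[m, m + n]`, to `P` in degree `m + n`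
    obtain ⟨A, B, hA, hB, α, β, γ, hT⟩ := t.exists_triangle X (m + n) (m + n + 1) rfl
    have hA : t.IsLE A (m + n) := ⟨hA⟩
    have hB : t.IsGE B (m + n + 1) := ⟨hB⟩
    have hA₁ := t.isLE_shift A (m + n) 1 (m + n - 1)
    have hA₂ := t.isLE_of_le (A⟦(1 : ℤ)⟧) (m + n - 1) (m + n + 1)
    have hBLE : t.IsLE B (m + n + 1) := t.isLE₂ _ (rot_of_distTriang _ hT) (m + n + 1) hXb hA₂
    obtain ⟨H, ⟨e⟩⟩ := exists_iso_singleFunctor_obj_of_isGE_of_isLE B (m + n + 1)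
    let P := Projective.over H
    let π : P ⟶ H := Projective.π H
    have hA₃ : (A⟦(1 : ℤ)⟧).IsLE (m + n + 1 - 1) := t.isLE_of_le (A⟦(1 : ℤ)⟧) (m + n - 1) _
    obtain ⟨u, hu⟩ : ∃ u : (singleFunctor C (m + n + 1)).obj P ⟶ X,
        (singleFunctor C (m + n + 1)).map π ≫ e.inv = u ≫ β :=
      Triangle.coyoneda_exact₃ _ hT _
        (eq_zero_of_projective (P := P) (m := m + n + 1) (T := A⟦(1 : ℤ)⟧) _)
    obtain ⟨Y, v, δ, hY⟩ := distinguished_cocone_triangle u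
    have hP₁ := t.isGE_shift ((singleFunctor C (m + n + 1)).obj P) (m + n + 1) 1 (m + n)
    have hP₂ := t.isLE_shift ((singleFunctor C (m + n + 1)).obj P) (m + n + 1) 1 (m + n)
    have : Y.IsGE m := t.isGE₂ _ (rot_of_distTriang _ hY) m ‹X.IsGE m›
      (t.isGE_of_ge (((singleFunctor C (m + n + 1)).obj P)⟦(1 : ℤ)⟧) m (m + n))
    have : Y.IsLE (m + n) := by
      refine (t.isLE_iff_orthogonal (m + n) (m + n + 1) rfl Y).2 fun Z f hZ => ?_
      obtain ⟨g, hg⟩ : ∃ g : B ⟶ Z, v ≫ f = β ≫ g :=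
        Triangle.yoneda_exact₂ _ hT (v ≫ f) (t.zero (X := A) _ (m + n) (m + n + 1))
      obtain ⟨κ, hκ⟩ := (IsShortExact.kernel_ι π).exists_distinguished (m + n + 1)
      have hK := t.isLE_shift ((singleFunctor C (m + n + 1)).obj (kernel π)) (m + n + 1) 1 (m + n)
      have huv : u ≫ v = 0 := comp_distTriang_mor_zero₁₂ _ hY
      obtain ⟨g', hg'⟩ : ∃ g' : ((singleFunctor C (m + n + 1)).obj (kernel π))⟦(1 : ℤ)⟧ ⟶ Z,
          e.inv ≫ g = κ ≫ g' :=
        Triangle.yoneda_exact₃ _ hκ _ (by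
          change (singleFunctor C (m + n + 1)).map π ≫ e.inv ≫ g = 0
          rw [reassoc_of% hu, ← hg, reassoc_of% huv, zero_comp])
      rw [t.zero g' (m + n) (m + n + 1), comp_zero] at hg'
      have hg0 : g = 0 := by rw [← cancel_epi e.inv, hg', comp_zero]
      obtain ⟨f', hf'⟩ : ∃ f' : ((singleFunctor C (m + n + 1)).obj P)⟦(1 : ℤ)⟧ ⟶ Z, f = δ ≫ f' :=
        Triangle.yoneda_exact₃ _ hY f (by
          change v ≫ f = 0
          rw [hg, hg0, comp_zero])
      rw [hf', t.zero f' (m + n) (m + n + 1), comp_zero]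
    obtain ⟨K, hK₁, hK₂, hK₃, ⟨eK⟩, f, hf⟩ := ih Y
    let s := ((singleFunctors C).shiftIso 1 (m + n) (m + n + 1) (by lia)).app P
    obtain ⟨φ, hφ⟩ := exists_Q_map_eq_to_single (K := K) (n := m + n) (P := P)
      (eK.inv ≫ δ ≫ s.hom)
    have hv : IsLeftApprox m v := IsLeftApprox.of_distinguished hY fun Z _ g => by
      have : Z.IsLE (m + n + 1 - 1) := t.isLE_of_le Z m (m + n + 1 - 1)
      exact eq_zero_of_projective (P := P) g
    refine ⟨CochainComplex.mappingCocone φ, ?_, ?_, fun i hi => ?_, ?_, ?_⟩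
    · rw [CochainComplex.isStrictlyGE_iff]
      intro i hi
      exact (K.isZero_of_isStrictlyGE m i).of_iso (mappingCoconeXIso φ i (by lia))
    · rw [CochainComplex.isStrictlyLE_iff]
      intro i hi
      exact (K.isZero_of_isStrictlyLE (m + n) i).of_iso (mappingCoconeXIso φ i (by lia))
    · exact projective_mappingCocone_X φ i (hK₃ i hi)
    · have h₁ := rot_of_distTriang _ (rot_of_distTriang _ hY)
      have h₂ := rot_of_distTriang _ (mappingCocone_triangle_distinguished φ)
      let e' := isoTriangleOfIso₁₂ _ _ h₁ h₂ eK s (by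
        change δ ≫ s.hom = eK.hom ≫ Q.map φ
        exact ((congrArg (eK.hom ≫ ·) hφ).trans (eK.hom_inv_id_assoc _)).symm)
      exact ⟨(shiftFunctor (DerivedCategory C) (1 : ℤ)).preimageIso (Triangle.π₃.mapIso e')⟩
    · exact ⟨v ≫ f ≫ (singleFunctor C m).map (mappingCoconeXIso φ m (by lia)).inv,
        hv.comp (hf.comp (.of_isIso m _))⟩

end Model

end GorensteinProjective

/-! ### Dévissage, and objects of finite Gorenstein projective dimension -/

namespace GorensteinProjective

open scoped ZeroObject
open DerivedCategory DerivedCategory.TStructure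

variable {C : Type u} [Category.{v} C] [Abelian C] [HasDerivedCategory.{w} C]

section Devissage

/-- A triangulated subcategory of the bounded derived category which contains the stalk complexes in
degree zero of the objects of `G` contains the bounded complexes with terms in `G`. -/
lemma prop_of_iso_Q_obj {G : ObjectProperty C} [G.IsClosedUnderIsomorphisms]
    {P : ObjectProperty (Bounded C)} [P.IsTriangulated] [P.IsClosedUnderIsomorphisms]
    (hP : G.map (boundedStalk C) ≤ P) (m : ℤ) (n : ℕ) (K : CochainComplex C ℤ)
    [K.IsStrictlyGE m] [K.IsStrictlyLE (m + n)] (hK : ∀ i, G (K.X i)) (X : Bounded C)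
    (e : X.obj ≅ Q.obj K) : P X := by
  have hsingle (i : ℤ) (M : C) (hM : G M) (X : Bounded C)
      (e : X.obj ≅ (singleFunctor C i).obj M) : P X := by
    let e' : X ≅ ((boundedStalk C).obj M)⟦-i⟧ := t.bounded.ι.preimageIso
      (e ≪≫ (((singleFunctors C).shiftIso (-i) i 0 (by lia)).app M).symm ≪≫
        ((t.bounded.ι.commShiftIso (-i)).app ((boundedStalk C).obj M)).symm)
    exact P.prop_of_iso e'.symm (P.le_shift (-i) _ (hP _ (G.prop_map_obj _ hM)))
  induction n generalizing K X with
  | zero =>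
    have : K.IsStrictlyLE m := by simpa using (inferInstance : K.IsStrictlyLE (m + (0 : ℕ)))
    obtain ⟨M, ⟨eM⟩⟩ := CochainComplex.exists_iso_single K m
    refine hsingle m M (G.prop_of_iso ?_ (hK m)) X (e ≪≫ Q.mapIso eM)
    exact (HomologicalComplex.eval C (ComplexShape.up ℤ) m).mapIso eM ≪≫
      HomologicalComplex.singleObjXSelf (ComplexShape.up ℤ) m M
  | succ n ih =>
    -- the top term of `K` is a subcomplex, and the quotient is a shorter complex
    let b : ℤ := m + n + 1
    have hb : K.IsStrictlyLE b := by
      have : K.IsStrictlyLE (m + ((n + 1 : ℕ) : ℤ)) := inferInstance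
      rwa [Nat.cast_add, Nat.cast_one, ← add_assoc] at this
    let i : (HomologicalComplex.single C (ComplexShape.up ℤ) b).obj (K.X b) ⟶ K :=
      HomologicalComplex.mkHomFromSingle (𝟙 _) (fun j hj =>
        (K.isZero_of_isStrictlyLE b j (by simp at hj; lia)).eq_of_tgt _ _)
    have hi : i.f b = (HomologicalComplex.singleObjXSelf (ComplexShape.up ℤ) b (K.X b)).hom := by
      simp [i]
    have hib : IsIso (i.f b) := by rw [hi]; infer_instance
    have hiz (j : ℤ) (hj : j ≠ b) :
        IsZero (((HomologicalComplex.single C (ComplexShape.up ℤ) b).obj (K.X b)).X j) :=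
      HomologicalComplex.isZero_single_obj_X (ComplexShape.up ℤ) b (K.X b) j hj
    have : Mono i := by
      have : ∀ j, Mono (i.f j) := fun j => by
        by_cases hj : j = b
        · subst hj; infer_instance
        · exact ⟨fun _ _ _ => (hiz j hj).eq_of_tgt _ _⟩
      exact HomologicalComplex.mono_of_mono_f i this
    let eC (j : ℤ) : (cokernel i).X j ≅ cokernel (i.f j) :=
      PreservesCokernel.iso (HomologicalComplex.eval C (ComplexShape.up ℤ) j) i
    have hCb : IsZero ((cokernel i).X b) := (isZero_cokernel_of_epi (i.f b)).of_iso (eC b)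
    let eX (j : ℤ) (hj : j ≠ b) : (cokernel i).X j ≅ K.X j :=
      eC j ≪≫ cokernelIsoOfEq ((hiz j hj).eq_of_src (i.f j) 0) ≪≫ cokernelZeroIsoTarget
    obtain ⟨w, hw⟩ := IsShortExact.cokernel_π i
    have hGE : CochainComplex.IsStrictlyGE (cokernel i) m := by
      rw [CochainComplex.isStrictlyGE_iff]
      intro j hj
      exact (K.isZero_of_isStrictlyGE m j).of_iso (eX j (by lia))
    have hLE : CochainComplex.IsStrictlyLE (cokernel i) (m + n) := by
      rw [CochainComplex.isStrictlyLE_iff]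
      intro j hj
      by_cases hj' : j = b
      · subst hj'; exact hCb
      · exact (K.isZero_of_isStrictlyLE b j (by lia)).of_iso (eX j hj')
    have hC (j : ℤ) : G ((cokernel i).X j) := by
      by_cases hj : j = b
      · subst hj
        exact G.prop_of_iso ((K.isZero_of_isStrictlyLE b (b + 1)).iso hCb) (hK (b + 1))
      · exact G.prop_of_iso (eX j hj).symm (hK j)
    let A : Bounded C := ⟨(singleFunctor C b).obj (K.X b), ⟨b, inferInstance⟩, ⟨b, inferInstance⟩⟩
    let B : Bounded C := ⟨Q.obj (cokernel i), ⟨m, (isGE_Q_obj_iff _ _).2 inferInstance⟩,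
      ⟨m + n, (isLE_Q_obj_iff _ _).2 inferInstance⟩⟩
    have hT := triangleOfSES_distinguished hw
    let δ : t.bounded.ι.obj B ⟶ (t.bounded.ι.obj A)⟦(1 : ℤ)⟧ := (triangleOfSES hw).mor₃
    let d : B ⟶ A⟦(1 : ℤ)⟧ :=
      t.bounded.ι.preimage (δ ≫ (t.bounded.ι.commShiftIso (1 : ℤ)).inv.app A)
    obtain ⟨X', f, g, hT'⟩ := distinguished_cocone_triangle₂ d
    have hT'' := t.bounded.ι.map_distinguished _ hT'
    let eT := isoTriangleOfIso₁₃ _ _ hT'' hT (Iso.refl _) (Iso.refl _) (by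
      have h : t.bounded.ι.map d ≫ (t.bounded.ι.commShiftIso (1 : ℤ)).hom.app A = δ := by
        rw [Functor.map_preimage, Category.assoc, Iso.inv_hom_id_app]
        exact Category.comp_id δ
      refine Eq.trans ?_ (h.trans (Category.id_comp δ).symm)
      exact (congrArg (_ ≫ ·) (CategoryTheory.Functor.map_id _ _)).trans (Category.comp_id _))
    have hX' : P X' := P.ext_of_isTriangulatedClosed₂ _ hT' (hsingle b _ (hK b) A (Iso.refl _))
      (ih (cokernel i) hC B (Iso.refl _))
    exact P.prop_of_iso (t.bounded.ι.preimageIso (Triangle.π₂.mapIso eT ≪≫ e.symm)) hX'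

end Devissage

section FiniteDimension

/-- The objects of the derived category one of whose syzygies is Gorenstein projective. No
boundedness is imposed. -/
def finiteGorensteinDimension (C : Type u) [Category.{v} C] [Abelian C]
    [HasDerivedCategory.{w} C] : ObjectProperty (DerivedCategory C) := fun X =>
  ∃ (m : ℤ) (M : C) (f : X ⟶ (singleFunctor C m).obj M),
    gorensteinProjective C M ∧ IsLeftApprox m f

/-- The syzygies in all sufficiently low degrees can be taken Gorenstein projective. -/
lemma finiteGorensteinDimension.exists_le {X : DerivedCategory C}
    (hX : finiteGorensteinDimension C X) : ∃ m₀ : ℤ, ∀ m ≤ m₀, ∃ (M : C)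
      (f : X ⟶ (singleFunctor C m).obj M), gorensteinProjective C M ∧ IsLeftApprox m f := by
  obtain ⟨m₀, M, f, hM, hf⟩ := hX
  refine ⟨m₀, fun m hm => ?_⟩
  induction m, hm using Int.leInductionDown with
  | base => exact ⟨M, f, hM, hf⟩
  | pred m hm ih =>
    obtain ⟨N, g, hN, hg⟩ := ih
    obtain ⟨K, hK, P, i, p, hP, h, -⟩ :=
      (isSyzygyClosed_gorensteinProjective C).syzygy N hN
    obtain ⟨k, hk⟩ := h.exists_isLeftApprox m
    exact ⟨K, g ≫ k, hK, (hg.of_le (by lia)).comp hk⟩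

instance : (finiteGorensteinDimension C).IsClosedUnderIsomorphisms where
  of_iso := by
    rintro X Y e ⟨m, M, f, hM, hf⟩
    exact ⟨m, M, e.inv ≫ f, hM, (IsLeftApprox.of_isIso m e.inv).comp hf⟩

lemma distinguished_of_iso₂ {T : Type u} [Category.{v} T] [HasZeroObject T] [HasShift T ℤ]
    [Preadditive T] [∀ n : ℤ, (shiftFunctor T n).Additive] [Pretriangulated T] {X Y Y' Z : T}
    {f : X ⟶ Y} {g : Y ⟶ Z} {δ : Z ⟶ X⟦(1 : ℤ)⟧} (h : Triangle.mk f g δ ∈ distTriang T)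
    (e : Y ≅ Y') : Triangle.mk (f ≫ e.hom) (e.inv ≫ g) δ ∈ distTriang T :=
  isomorphic_distinguished _ h _ (Triangle.isoMk _ _ (Iso.refl _) e.symm (Iso.refl _)
    (by change (f ≫ e.hom) ≫ e.inv = 𝟙 X ≫ f; simp)
    (by change (e.inv ≫ g) ≫ 𝟙 Z = e.inv ≫ g; simp)
    (by change δ ≫ (𝟙 X)⟦(1 : ℤ)⟧' = 𝟙 Z ≫ δ; simp))

instance : (finiteGorensteinDimension C).IsTriangulated where
  exists_zero := by
    refine ⟨(singleFunctor C 0).obj 0, (singleFunctor C 0).map_isZero (isZero_zero C),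
      0, 0, 𝟙 _, gorensteinProjective_of_projective 0, .of_isIso 0 _⟩
  isStableUnderShiftBy a :=
    { le_shift := by
        rintro X ⟨m, M, f, hM, hf⟩
        exact ⟨m - a, M, f⟦a⟧' ≫ ((singleFunctors C).shiftIso a (m - a) m (by lia)).hom.app M, hM,
          (hf.shift a (m - a) (by lia)).comp (.of_isIso _ _)⟩ }
  toIsTriangulatedClosed₂ := .mk' fun T hT h₁ h₃ => by
    obtain ⟨m₁, h₁⟩ := h₁.exists_le
    obtain ⟨m₃, h₃⟩ := h₃.exists_le
    obtain ⟨M, f, hM, hf⟩ := h₁ (min m₁ m₃) (min_le_left _ _)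
    obtain ⟨N, g, hN, hg⟩ := h₃ (min m₁ m₃) (min_le_right _ _)
    generalize min m₁ m₃ = m at *
    obtain ⟨W, i, j, δ, c, hW, hc⟩ := IsLeftApprox.exists_of_extension hT hf hg
    have : W.IsLE m := t.isLE₂ _ hW m (inferInstanceAs (((singleFunctor C m).obj M).IsLE m))
      (inferInstanceAs (((singleFunctor C m).obj N).IsLE m))
    have : W.IsGE m := t.isGE₂ _ hW m (inferInstanceAs (((singleFunctor C m).obj M).IsGE m))
      (inferInstanceAs (((singleFunctor C m).obj N).IsGE m))
    obtain ⟨L, ⟨e⟩⟩ := exists_iso_singleFunctor_obj_of_isGE_of_isLE W m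
    obtain ⟨i', hi'⟩ := (singleFunctor C m).map_surjective (i ≫ e.hom)
    obtain ⟨j', hj'⟩ := (singleFunctor C m).map_surjective (e.inv ≫ j)
    have hS : IsShortExact i' j' := isShortExact_of_distinguished (m := m) (δ := δ) (by
      rw [hi', hj']
      exact distinguished_of_iso₂ hW e)
    exact ⟨m, L, c ≫ e.hom, gorensteinProjective_of_extension hS hM hN,
      hc.comp (.of_isIso m _)⟩

variable [EnoughProjectives C]

/-- A bounded retract of an object with a Gorenstein projective syzygy is isomorphic to a bounded
complex with Gorenstein projective terms. -/
lemma finiteGorensteinDimension.exists_iso_Q_obj_of_retract {X Y : DerivedCategory C}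
    (hY : finiteGorensteinDimension C Y) (r : Retract X Y) {a b : ℤ} [X.IsGE a] [X.IsLE b] :
    ∃ K : CochainComplex C ℤ, (∃ a b : ℤ, K.IsStrictlyGE a ∧ K.IsStrictlyLE b) ∧
      (∀ i, gorensteinProjective C (K.X i)) ∧ Nonempty (X ≅ Q.obj K) := by
  obtain ⟨m₀, hm₀⟩ := hY.exists_le
  let m := min m₀ a
  obtain ⟨N, g, hN, hg⟩ := hm₀ m (min_le_left _ _)
  have : X.IsGE m := t.isGE_of_ge X m a (min_le_right _ _)
  have : X.IsLE (m + (b - m).toNat) := t.isLE_of_le X b _ (by lia)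
  obtain ⟨K, hK₁, hK₂, hK₃, ⟨e⟩, f, hf⟩ := exists_model m (b - m).toNat X
  obtain ⟨P, _, α, β, γ, d, h⟩ := exists_stable_retract r hf hg
  refine ⟨K, ⟨m, _, hK₁, hK₂⟩, fun i => ?_, ⟨e⟩⟩
  obtain hi | rfl | hi := lt_trichotomy i m
  · have := (K.isZero_of_isStrictlyGE m i).projective
    exact gorensteinProjective_of_projective _
  · exact gorensteinProjective_of_stable_retract hN α β γ d h
  · have := hK₃ i hi
    exact gorensteinProjective_of_projective _

end FiniteDimension

end GorensteinProjective

/-! ### Gorenstein projective modules -/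

namespace GorensteinProjective

section FGModuleCat

variable {R : Type u} [Ring R] [IsNoetherianRing R]

lemma epi_iff_surjective {M N : FGModuleCat.{u} R} (f : M ⟶ N) :
    Epi f ↔ Function.Surjective f.hom.hom := by
  rw [← ModuleCat.epi_iff_surjective]
  exact ((forget₂ (FGModuleCat.{u} R) (ModuleCat.{u} R)).epi_map_iff_epi f).symm

instance projective_of_module_projective (P : FGModuleCat.{u} R) [Module.Projective R P] :
    Projective P where
  factors {E X} f e he := by
    obtain ⟨h, hh⟩ := Module.projective_lifting_property e.hom.hom f.hom.hom
      ((epi_iff_surjective e).1 he)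
    exact ⟨FGModuleCat.ofHom h, FGModuleCat.hom_ext hh⟩

lemma exists_fin_epi (M : FGModuleCat.{u} R) :
    ∃ (n : ℕ) (p : FGModuleCat.of R (Fin n → R) ⟶ M), Epi p := by
  obtain ⟨n, f, hf⟩ := Module.Finite.exists_fin' R M
  exact ⟨n, FGModuleCat.ofHom f, (epi_iff_surjective _).2 hf⟩

lemma exists_fin_retract (P : FGModuleCat.{u} R) [Projective P] :
    ∃ n : ℕ, Nonempty (Retract P (FGModuleCat.of R (Fin n → R))) := by
  obtain ⟨n, p, hp⟩ := exists_fin_epi P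
  exact ⟨n, ⟨⟨Projective.factorThru (𝟙 P) p, p, Projective.factorThru_comp _ _⟩⟩⟩

lemma module_projective_of_projective (P : FGModuleCat.{u} R) [Projective P] :
    Module.Projective R P := by
  obtain ⟨n, ⟨r⟩⟩ := exists_fin_retract P
  exact Module.Projective.of_split r.i.hom.hom r.r.hom.hom
    (congrArg (fun f : P ⟶ P => f.hom.hom) r.retract)

instance : EnoughProjectives (FGModuleCat.{u} R) where
  presentation M := by
    obtain ⟨n, p, hp⟩ := exists_fin_epi M
    have : Module.Projective R (FGModuleCat.of R (Fin n → R)) :=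
      inferInstanceAs (Module.Projective R (Fin n → R))
    exact ⟨{ p := _, f := p, projective := inferInstance, epi := hp }⟩

/-- If `Hom_R(X, R)` is exact in a degree, then so is `Hom_R(X, Q)` for every finitely generated
projective module `Q`, since `Q` is a direct summand of some `R ^ n`. -/
lemma exists_extension_of_exact {A B D : FGModuleCat.{u} R} {a : A ⟶ B} {b : B ⟶ D}
    (H : ∀ f : B ⟶ FGModuleCat.of R R, a ≫ f = 0 → ∃ g : D ⟶ FGModuleCat.of R R, b ≫ g = f)
    (Q : FGModuleCat.{u} R) [Projective Q] (f : B ⟶ Q) (hf : a ≫ f = 0) :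
    ∃ g : D ⟶ Q, b ≫ g = f := by
  obtain ⟨n, ⟨r⟩⟩ := exists_fin_retract Q
  let π (j : Fin n) : FGModuleCat.of R (Fin n → R) ⟶ FGModuleCat.of R R :=
    FGModuleCat.ofHom (LinearMap.proj j)
  have h (j : Fin n) := H (f ≫ r.i ≫ π j) (by rw [reassoc_of% hf, zero_comp])
  choose g hg using h
  let g' : D ⟶ FGModuleCat.of R (Fin n → R) :=
    FGModuleCat.ofHom (LinearMap.pi fun j => (g j).hom.hom)
  have hg' : b ≫ g' = f ≫ r.i := by
    ext x j
    exact congrArg (fun h : B ⟶ FGModuleCat.of R R => h.hom.hom x) (hg j)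
  exact ⟨g' ≫ r.r, by rw [reassoc_of% hg', r.retract, Category.comp_id]⟩

end FGModuleCat

section TotallyAcyclic

variable {C : Type u} [Category.{v} C] [Abelian C]

lemma isShortExact_cycles {X : CochainComplex C ℤ} (hX : X.Acyclic) {i j : ℤ} (hij : i + 1 = j) :
    IsShortExact (X.iCycles i) (X.toCycles i j) := by
  have : Epi (X.toCycles i j) :=
    Preadditive.epi_of_isZero_cokernel' _
    (X.homologyIsCokernel i j (by subst hij; simp)) (hX j).isZero_homology
  have w : X.iCycles i ≫ X.toCycles i j = 0 := by
    rw [← cancel_mono (X.iCycles j), Category.assoc, X.toCycles_i, X.iCycles_d, zero_comp]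
  refine .mk_of_lift w fun x hx => ?_
  have hx' : x ≫ X.d i j = 0 := by rw [← X.toCycles_i, reassoc_of% hx, zero_comp]
  exact ⟨X.liftCycles x j (by subst hij; simp) hx', X.liftCycles_i _ _ _ _⟩

/-- The cycles of an acyclic complex `X` of projective objects form a chain of total syzygies if
`Hom(X, Q)` is acyclic for all projective objects `Q`. -/
lemma isTotalSyzygy_cycles {X : CochainComplex C ℤ} (hX : X.Acyclic) (hP : ∀ i, Projective (X.X i))
    (H : ∀ (i j k : ℤ), i + 1 = j → j + 1 = k → ∀ (Q : C) [Projective Q] (f : X.X j ⟶ Q),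
      X.d i j ≫ f = 0 → ∃ g : X.X k ⟶ Q, X.d j k ≫ g = f) {i j : ℤ} (hij : i + 1 = j) :
    IsTotalSyzygy (X.cycles i) (X.cycles j) := by
  refine ⟨X.X i, X.iCycles i, X.toCycles i j, hP i, isShortExact_cycles hX hij, fun Q _ g => ?_⟩
  obtain ⟨h, hh⟩ := H (i - 1 - 1) (i - 1) i (by lia) (by lia) Q (X.toCycles (i - 1) i ≫ g)
    (by rw [X.d_toCycles_assoc, zero_comp])
  have := (isShortExact_cycles hX (show i - 1 + 1 = i by lia)).epi
  exact ⟨h, by rw [← cancel_epi (X.toCycles (i - 1) i), X.toCycles_i_assoc, hh]⟩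

/-- A relation in which every element has a successor and a predecessor has a bi-infinite chain
through every element. -/
lemma exists_int_chain {α : Type*} {r : α → α → Prop} (hs : ∀ x, ∃ y, r x y)
    (hp : ∀ x, ∃ y, r y x) (a : α) : ∃ f : ℤ → α, f 0 = a ∧ ∀ n, r (f n) (f (n + 1)) := by
  choose s hs using hs
  choose p hp using hp
  refine ⟨fun n => match n with
    | Int.ofNat n => s^[n] a
    | Int.negSucc n => p^[n + 1] a, rfl, fun n => ?_⟩
  match n with
  | Int.ofNat n =>
    change r (s^[n] a) (s^[n + 1] a)
    rw [Function.iterate_succ_apply']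
    exact hs _
  | Int.negSucc 0 => exact hp a
  | Int.negSucc (n + 1) =>
    change r (p^[n + 1 + 1] a) (p^[n + 1] a)
    rw [Function.iterate_succ_apply' p (n + 1)]
    exact hp _

/-- A Gorenstein projective object is the zeroth cycles of an acyclic complex `X` of projective
objects such that `Hom(X, Q)` is acyclic for all projective objects `Q`. -/
lemma exists_totallyAcyclic {M : C} (hM : gorensteinProjective C M) :
    ∃ X : CochainComplex C ℤ, X.Acyclic ∧ (∀ i, Projective (X.X i)) ∧
      (∀ (i j k : ℤ), i + 1 = j → j + 1 = k → ∀ (Q : C) [Projective Q] (f : X.X j ⟶ Q),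
        X.d i j ≫ f = 0 → ∃ g : X.X k ⟶ Q, X.d j k ≫ g = f) ∧ Nonempty (M ≅ X.cycles 0) := by
  obtain ⟨N, hN, h⟩ := exists_int_chain (α := (gorensteinProjective C).FullSubcategory)
    (r := fun K L => IsTotalSyzygy K.obj L.obj)
    (fun K => by
      obtain ⟨L, hL, h⟩ := (isSyzygyClosed_gorensteinProjective C).cosyzygy _ K.property
      exact ⟨⟨L, hL⟩, h⟩)
    (fun L => by
      obtain ⟨K, hK, h⟩ := (isSyzygyClosed_gorensteinProjective C).syzygy _ L.property
      exact ⟨⟨K, hK⟩, h⟩) ⟨M, hM⟩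
  choose P i p hP hip H using h
  let d (n : ℤ) : P n ⟶ P (n + 1) := p n ≫ i (n + 1)
  let X : CochainComplex C ℤ := CochainComplex.of P d
    (fun n => by simp [d, reassoc_of% (hip (n + 1)).zero])
  have hd (n : ℤ) : X.d n (n + 1) = p n ≫ i (n + 1) := CochainComplex.of_d P d n
  have (n : ℤ) : Mono (i n) := (hip n).mono
  have (n : ℤ) : Epi (p n) := (hip n).epi
  refine ⟨X, fun n => ?_, hP, ?_, ?_⟩
  · obtain ⟨n, rfl⟩ : ∃ m, n = m + 1 := ⟨n - 1, by lia⟩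
    rw [X.exactAt_iff' n (n + 1) (n + 1 + 1) (by simp) (by simp),
      ShortComplex.exact_iff_exact_up_to_refinements]
    have key {A : C} (x : A ⟶ P (n + 1)) (hx : x ≫ p (n + 1) ≫ i (n + 1 + 1) = 0) :
        ∃ (A' : C) (π : A' ⟶ A) (_ : Epi π) (z : A' ⟶ P n), π ≫ x = z ≫ p n ≫ i (n + 1) := by
      rw [← Category.assoc] at hx
      obtain ⟨y, hy⟩ := (hip (n + 1)).exists_lift x (zero_of_comp_mono _ hx)
      obtain ⟨A', π, hπ, z, hz⟩ := surjective_up_to_refinements_of_epi (p n) y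
      exact ⟨A', π, hπ, z, by rw [← hy, reassoc_of% hz]⟩
    rw [← hd n, ← hd (n + 1)] at key
    exact fun A x hx => key x hx
  · rintro n _ _ rfl rfl Q _ f hf
    rw [hd, Category.assoc] at hf
    obtain ⟨g, hg⟩ := (hip (n + 1)).exists_desc f (zero_of_epi_comp _ hf)
    obtain ⟨g', hg'⟩ := H (n + 1 + 1) Q g
    exact ⟨g', by rw [hd, Category.assoc, hg', hg]⟩
  · have w : i 0 ≫ X.d 0 (0 + 1) = 0 := by rw [hd, reassoc_of% (hip 0).zero, zero_comp]
    let φ : (N 0).obj ⟶ X.cycles 0 := X.liftCycles (i 0) (0 + 1) (by simp) w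
    have hφ : φ ≫ X.iCycles 0 = i 0 := X.liftCycles_i _ _ _ _
    obtain ⟨ψ, hψ⟩ := (hip 0).exists_lift (X.iCycles 0) (by
      have := X.iCycles_d 0 (0 + 1)
      rw [hd, ← Category.assoc] at this
      exact zero_of_comp_mono _ this)
    let e : (N 0).obj ≅ X.cycles 0 := ⟨φ, ψ, by rw [← cancel_mono (i 0)]; simp [hψ, hφ],
      by rw [← cancel_mono (X.iCycles 0)]; simp [hψ, hφ]⟩
    exact ⟨eqToIso (congrArg ObjectProperty.FullSubcategory.obj hN.symm) ≪≫ e⟩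

end TotallyAcyclic

section Gproj

variable (R : Type u) [Ring R] [IsNoetherianRing R]

lemma gproj_eq_gorensteinProjective : Gproj R = gorensteinProjective (FGModuleCat.{u} R) := by
  ext M
  constructor
  · rintro ⟨X, hX, ⟨e⟩⟩
    have hP (i : ℤ) : Projective (X.X i) := by
      have := hX.projective i
      infer_instance
    have H (i j : ℤ) (hij : i + 1 = j) : IsTotalSyzygy (X.cycles i) (X.cycles j) :=
      isTotalSyzygy_cycles hX.acyclic hP (by
        rintro i j _ hij rfl
        obtain rfl : i = j - 1 := by lia
        exact exists_extension_of_exact fun f hf => (hX.hom_acyclic j f).1 hf) hij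
    refine IsSyzygyClosed.le (G := fun N => ∃ i : ℤ, Nonempty (N ≅ X.cycles i))
      ⟨?_, ?_⟩ M ⟨0, ⟨e⟩⟩
    · rintro N ⟨i, ⟨e⟩⟩
      exact ⟨X.cycles (i - 1), ⟨i - 1, ⟨Iso.refl _⟩⟩, (H _ i (by lia)).of_iso (Iso.refl _) e.symm⟩
    · rintro N ⟨i, ⟨e⟩⟩
      exact ⟨X.cycles (i + 1), ⟨i + 1, ⟨Iso.refl _⟩⟩, (H i _ rfl).of_iso e (Iso.refl _)⟩
  · intro hM
    obtain ⟨X, hX, hP, H, e⟩ := exists_totallyAcyclic hM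
    have : Projective (FGModuleCat.of R R) := by
      have : Module.Projective R (FGModuleCat.of R R) := inferInstanceAs (Module.Projective R R)
      infer_instance
    refine ⟨X, ⟨fun i => module_projective_of_projective _, hX, fun i f => ⟨fun hf => ?_, ?_⟩⟩, e⟩
    · exact H (i - 1) i (i + 1) (by lia) rfl _ f hf
    · rintro ⟨g, rfl⟩
      exact (X.d_comp_d_assoc _ _ _ g).trans zero_comp

end Gproj

end GorensteinProjective

/-! ### The bounded derived category of finitely generated modules -/

namespace GorensteinProjective

open DerivedCategory DerivedCategory.TStructure

section BoundedFgp

variable (R : Type u) [Ring R] [IsNoetherianRing R] [HasDerivedCategory.{w} (FGModuleCat.{u} R)]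

instance : (Gproj R).IsClosedUnderIsomorphisms := by
  rw [gproj_eq_gorensteinProjective]
  infer_instance

variable {R} in
lemma prop_of_boundedFgp {P : ObjectProperty (Bounded (FGModuleCat.{u} R))} [P.IsTriangulated]
    [P.IsClosedUnderIsomorphisms] (hP : (Gproj R).map (boundedStalk _) ≤ P) : boundedFgp R ≤ P := by
  rintro X ⟨K, ⟨a, b, _, _⟩, hK, ⟨e⟩⟩
  have : K.IsStrictlyLE (a + (b - a).toNat) := K.isStrictlyLE_of_le b _ (by lia)
  exact prop_of_iso_Q_obj hP a (b - a).toNat K hK X e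

variable {R} in
lemma boundedFgp_of_retract {X Y : Bounded (FGModuleCat.{u} R)} (r : Retract X Y)
    (hY : finiteGorensteinDimension _ Y.obj) : boundedFgp R X := by
  obtain ⟨⟨a, ha⟩, ⟨b, hb⟩⟩ := X.property
  have : X.obj.IsGE a := ha
  have : X.obj.IsLE b := hb
  obtain ⟨K, hK, hK', e⟩ : ∃ K : CochainComplex (FGModuleCat.{u} R) ℤ,
      (∃ a b : ℤ, K.IsStrictlyGE a ∧ K.IsStrictlyLE b) ∧
        (∀ i, gorensteinProjective _ (K.X i)) ∧ Nonempty (X.obj ≅ Q.obj K) :=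
    hY.exists_iso_Q_obj_of_retract (X := X.obj) (r.map t.bounded.ι) (a := a) (b := b)
  rw [← gproj_eq_gorensteinProjective] at hK'
  exact ⟨K, hK, hK', e⟩

lemma map_boundedStalk_le_inverseImage : (Gproj R).map (boundedStalk _) ≤
    (finiteGorensteinDimension (FGModuleCat.{u} R)).inverseImage t.bounded.ι := by
  rintro X ⟨M, hM, ⟨e⟩⟩
  rw [gproj_eq_gorensteinProjective] at hM
  refine ((finiteGorensteinDimension _).inverseImage t.bounded.ι).prop_of_iso e ?_
  exact ⟨0, M, 𝟙 ((singleFunctor _ 0).obj M), hM, .of_isIso 0 (𝟙 ((singleFunctor _ 0).obj M))⟩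

lemma boundedFgp_eq_inverseImage :
    boundedFgp R = (finiteGorensteinDimension _).inverseImage t.bounded.ι :=
  le_antisymm (prop_of_boundedFgp (map_boundedStalk_le_inverseImage R))
    fun X hX => boundedFgp_of_retract (.refl X) hX

instance : (boundedFgp R).IsTriangulated := by
  rw [boundedFgp_eq_inverseImage]
  infer_instance

instance : (boundedFgp R).IsStableUnderRetracts where
  of_retract {X Y} r hY := by
    rw [boundedFgp_eq_inverseImage] at hY
    exact boundedFgp_of_retract r hY

lemma map_boundedStalk_le_boundedFgp : (Gproj R).map (boundedStalk _) ≤ boundedFgp R :=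
  (map_boundedStalk_le_inverseImage R).trans (boundedFgp_eq_inverseImage R).ge

end BoundedFgp

end GorensteinProjective

theorem theorem2p7 (k : Type v) (R : Type u) [CommRing k] [IsArtinianRing k] [Ring R]
    [Algebra k R] [Module.Finite k R] :
    haveI : IsNoetherianRing R := isNoetherianRing_of_artinAlgebra k R
    ∀ [HasDerivedCategory.{w} (FGModuleCat.{u} R)],
      IsThickSubcategory (boundedFgp R) ∧
      boundedFgp R =
        triangulatedSubcategoryGenerated
          ((Gproj R).map (boundedStalk (FGModuleCat.{u} R))) := by
  have : IsNoetherianRing R := isNoetherianRing_of_artinAlgebra k R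
  intro _
  refine ⟨⟨inferInstance, inferInstance⟩, le_antisymm ?_ ?_⟩
  · exact fun X hX P _ _ hP => GorensteinProjective.prop_of_boundedFgp hP X hX
  · exact fun X hX => hX _ inferInstance inferInstance
      (GorensteinProjective.map_boundedStalk_le_boundedFgp R)
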